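/- Theorem (Time complexity of the dualization algorithm). Let $P$ be a poset with $n$ elements, given by the $n\times n$ $0/1$-matrix of its order relation, and let $\mathcal L(P)$ be the distributive lattice of downsets of $P$, ordered by inclusion. Antichains $\mathcal A,\mathcal B\subseteq\mathcal L(P)$ (given as lists of characteristic vectors) are called dual if $A\not\subseteq B$ for all $A\in\mathcal A$, $B\in\mathcal B$, and every $X\in\mathcal L(P)$ satisfies $X\subseteq B$ for some $B\in\mathcal B$ or $A\subseteq X$ for some $A\in\mathcal A$. For $p\in P$ let $\downarrow p$ and $\uparrow p$ be the principal downset and the principal upset of $p$ in $P$; for a nonempty finite family $\mathcal C$ of subsets of $P$ let $\mathrm{freq}_{\mathcal C}(p)=|\{C\in\mathcal C: p\in C\}|/|\mathcal C|$; and let $\overline{\mathcal B}=\{P\setminus B: B\in\mathcal B\}$. Consider the following recursive algorithm TestDuality$(\mathcal A,\mathcal B,P)$, for finite sets $\mathcal A,\mathcal B\subseteq\mathcal L(P)$: 1. If $\mathcal A=\emptyset$, return whether $P\in\mathcal B$; if $\mathcal A\ne\emptyset$ and $\mathcal B=\emptyset$, return whether $\emptyset\in\mathcal A$. 2. Otherwise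 let $n=|P|$, $m=\max_{p\in P}(|{\downarrow p}|+|{\uparrow p}|)$ (with $m=0$ if $P=\emptyset$) and $N=|\mathcal A|+|\mathcal B|$. 3. If $m>n^{1/3}$, let $p$ be an element that maximizes $|{\downarrow p}|+|{\uparrow p}|$. 4. If $m\le n^{1/3}$: if $\mathrm{freq}_{\mathcal A}(p)<\frac1{m\log_{4/3}N}$ and $\mathrm{freq}_{\overline{\mathcal B}}(p)<\frac1{m^2\log_{4/3}N}$ for all $p\in P$ (in particular if $P=\emptyset$), return false; otherwise let $p$ be an element that maximizes $\max(\mathrm{freq}_{\mathcal A}(p),\mathrm{freq}_{\overline{\mathcal B}}(p))$. 5. Return TestDuality$(\mathcal A_1^p,\mathcal B_1^p,P\setminus{\downarrow p})\wedge$ TestDuality$(\mathcal A_2^p,\mathcal B_2^p,P\setminus{\uparrow p})$, where $\mathcal A_1^p=\{A\setminus{\downarrow p}: A\in\mathcal A\}$, $\mathcal B_1^p=\{B\setminus{\downarrow p}: p\in B\in\mathcal B\}$, $\mathcal A_2^p=\{A\in\mathcal A: p\notin A\}$, $\mathcal B_2^p=\{B\setminus{\uparrow p}: B\in\mathcal B\}$.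 This algorithm, written out as a program of a first-order functional language over binary trees (lists) in which each elementary operation (access to the argument, construction or inspection of a tree node, test, function call) costs one step, halts for every such $P$ and all antichains $\mathcal A,\mathcal B\subseteq\mathcal L(P)$ and decides whether $\mathcal A$ and $\mathcal B$ are dual. Moreover, its running time is $2^{O(n^{0.67}\log^3(|\mathcal A|+|\mathcal B|))}$: there is an absolute constant $C$ such that, whenever $n\ge1$ and $|\mathcal A|+|\mathcal B|\ge2$, it halts after at most $2^{C\,n^{0.67}\,(\log_2(|\mathcal A|+|\mathcal B|))^3}$ steps. -/

import Mathlib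

/-! ### Duality of antichains -/

/-- `A` and `B` are dual in the partially ordered set `L`: no element of `A` lies below an element
of `B`, and every element of `L` lies below some element of `B` or above some element of `A`. -/
def AreDual {L : Type*} [PartialOrder L] (A B : Set L) : Prop :=
  (∀ a ∈ A, ∀ b ∈ B, ¬ a ≤ b) ∧ ∀ x : L, (∃ b ∈ B, x ≤ b) ∨ (∃ a ∈ A, a ≤ x)

namespace TreeLang

/-! ### The machine model

A first-order functional language over binary trees.  A program is a finite family of mutually
recursive functions, each taking one tree and returning one tree.  Running time is the number of
evaluated nodes of expressions: every access to the argument, every construction or inspection of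
one tree node, every test and every function call costs one step. -/

/-- The data: binary trees.  The only atom is `nil`. -/
inductive Tree : Type
  | nil : Tree
  | cons : Tree → Tree → Tree

namespace Tree

/-- Left component (`nil` for the atom). -/
def head : Tree → Tree
  | nil => nil
  | cons a _ => a

/-- Right component (`nil` for the atom). -/
def tail : Tree → Tree
  | nil => nil
  | cons _ b => b

/-- The list with the given entries. -/
def ofList : List Tree → Tree
  | [] => nil
  | a :: l => cons a (ofList l)

/-- Truth values: `nil` is false, `cons nil nil` is true. -/
def ofBool : Bool → Tree
  | false => nil
  | true => cons nil nil

end Tree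

/-- Expressions, with function names in `F`.  `input` is the argument of the function whose body
contains the expression. -/
inductive Expr (F : Type) : Type
  | input : Expr F
  | nil : Expr F
  | cons : Expr F → Expr F → Expr F
  | head : Expr F → Expr F
  | tail : Expr F → Expr F
  | ite : Expr F → Expr F → Expr F → Expr F
  | call : F → Expr F → Expr F

/-- `Evaluates P x e v t`: in the program `P` (which gives each function name its body), with
argument `x`, the expression `e` evaluates to `v` in exactly `t` steps. -/
inductive Evaluates {F : Type} (P : F → Expr F) : Tree → Expr F → Tree → ℕ → Prop
  | input (x : Tree) : Evaluates P x .input x 1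
  | nil (x : Tree) : Evaluates P x .nil .nil 1
  | cons {x a b : Tree} {e₁ e₂ : Expr F} {s t : ℕ} :
      Evaluates P x e₁ a s → Evaluates P x e₂ b t →
      Evaluates P x (.cons e₁ e₂) (.cons a b) (s + t + 1)
  | head {x a : Tree} {e : Expr F} {s : ℕ} :
      Evaluates P x e a s → Evaluates P x (.head e) a.head (s + 1)
  | tail {x a : Tree} {e : Expr F} {s : ℕ} :
      Evaluates P x e a s → Evaluates P x (.tail e) a.tail (s + 1)
  | iteTrue {x a b v : Tree} {c e₁ e₂ : Expr F} {s t : ℕ} :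
      Evaluates P x c (.cons a b) s → Evaluates P x e₁ v t →
      Evaluates P x (.ite c e₁ e₂) v (s + t + 1)
  | iteFalse {x v : Tree} {c e₁ e₂ : Expr F} {s t : ℕ} :
      Evaluates P x c .nil s → Evaluates P x e₂ v t →
      Evaluates P x (.ite c e₁ e₂) v (s + t + 1)
  | call {x y v : Tree} {f : F} {e : Expr F} {s t : ℕ} :
      Evaluates P x e y s → Evaluates P y (P f) v t →
      Evaluates P x (.call f e) v (s + t + 1)

/-- The program `P`, started in the function `f` on the argument `x`, halts with output `v` after
exactly `t` steps. -/
def HaltsWith {F : Type} (P : F → Expr F) (f : F) (x v : Tree) (t : ℕ) : Prop :=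
  Evaluates P x (P f) v t

/-- Evaluation is deterministic, so output and running time are unique. -/
theorem Evaluates.unique {F : Type} {P : F → Expr F} {x : Tree} {e : Expr F} {v w : Tree}
    {s t : ℕ} (h₁ : Evaluates P x e v s) (h₂ : Evaluates P x e w t) : v = w ∧ s = t := by
  induction h₁ generalizing w t with
  | input x => cases h₂; exact ⟨rfl, rfl⟩
  | nil x => cases h₂; exact ⟨rfl, rfl⟩
  | cons _ _ ih₁ ih₂ =>
    cases h₂ with
    | cons k₁ k₂ =>
      obtain ⟨rfl, rfl⟩ := ih₁ k₁
      obtain ⟨rfl, rfl⟩ := ih₂ k₂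
      exact ⟨rfl, rfl⟩
  | head _ ih =>
    cases h₂ with
    | head k => obtain ⟨rfl, rfl⟩ := ih k; exact ⟨rfl, rfl⟩
  | tail _ ih =>
    cases h₂ with
    | tail k => obtain ⟨rfl, rfl⟩ := ih k; exact ⟨rfl, rfl⟩
  | iteTrue _ _ ih₁ ih₂ =>
    cases h₂ with
    | iteTrue k₁ k₂ =>
      obtain ⟨-, rfl⟩ := ih₁ k₁
      obtain ⟨rfl, rfl⟩ := ih₂ k₂
      exact ⟨rfl, rfl⟩
    | iteFalse k₁ k₂ => exact absurd (ih₁ k₁).1 (by simp)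
  | iteFalse _ _ ih₁ ih₂ =>
    cases h₂ with
    | iteTrue k₁ k₂ => exact absurd (ih₁ k₁).1 (by simp)
    | iteFalse k₁ k₂ =>
      obtain ⟨-, rfl⟩ := ih₁ k₁
      obtain ⟨rfl, rfl⟩ := ih₂ k₂
      exact ⟨rfl, rfl⟩
  | call _ _ ih₁ ih₂ =>
    cases h₂ with
    | call k₁ k₂ =>
      obtain ⟨rfl, rfl⟩ := ih₁ k₁
      obtain ⟨rfl, rfl⟩ := ih₂ k₂
      exact ⟨rfl, rfl⟩

namespace Expr

variable {F : Type}

/-- The constant "true"; the constant "false" is `nil`. -/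
def tt : Expr F := cons nil nil

/-- Negation of a truth value. -/
def not (a : Expr F) : Expr F := ite a nil tt

/-- Short-circuit conjunction of truth values. -/
def and (a b : Expr F) : Expr F := ite a b nil

/-- Short-circuit disjunction of truth values. -/
def or (a b : Expr F) : Expr F := ite a tt b

/-- Exclusive disjunction of truth values. -/
def xor (a b : Expr F) : Expr F := ite a (not b) b

/-- The numeral `k` in unary notation, as a list of `k` atoms. -/
def unary : ℕ → Expr F
  | 0 => nil
  | k + 1 => cons nil (unary k)

/-- `tail` applied `k` times. -/
def drop : ℕ → Expr F → Expr F
  | 0, e => e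
  | k + 1, e => tail (drop k e)

/-- A function of several arguments receives them as a list; this is its `k`-th argument, counted
from `0`. -/
def arg (k : ℕ) : Expr F := head (drop k input)

/-- The list of the given expressions. -/
def list : List (Expr F) → Expr F
  | [] => nil
  | a :: l => cons a (list l)

/-- Call of the function `f` with the given list of arguments. -/
def app (f : F) (l : List (Expr F)) : Expr F := call f (list l)

end Expr

/-! ### The dualization algorithm

Conventions.  Fix the elements `0, …, n - 1` of the input poset.  A subset is a list of `n` truth
values, a family of subsets is a list of subsets without repetitions, the order relation is the
list `M` of the rows of its `n × n` matrix (the entry in row `i` and column `j` says whether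
`i ≤ j`), and the subposet on which the recursion currently works is given by the subset `S` of its
elements.  Elements, cardinalities and the numbers `n`, `m`, `N` are unary (a number is a list of
atoms); the large numbers in the logarithmic frequency test are binary, with the least significant
bit first. -/

/-- The names of the functions of the program. -/
inductive Fn : Type
  | nth | col | inter | diff | down | up | full
  | eq | mem | insert | removeAll | having | lacking | complement
  | size | length | elements
  | add | mul | lt | max
  | addBin | timesBin | powTimesBin | ltBin
  | nbhd | withNbhd | score | withScore | better | best
  | infrequent | allInfrequent
  | easyTest | testDuality | branchLarge | branchFrequent | decompose | main

open TreeLang.Expr in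
/-- The bodies of the functions. -/
def code : Fn → Expr Fn
  -- The `i`-th entry of the list `x`.
  | .nth => let x := arg 0; let i := arg 1
      ite i (app .nth [tail x, tail i]) (head x)
  -- The `i`-th column of the matrix `M`.
  | .col => let M := arg 0; let i := arg 1
      ite M (cons (app .nth [head M, i]) (app .col [tail M, i])) nil
  -- The intersection of the subsets `x` and `y`.
  | .inter => let x := arg 0; let y := arg 1
      ite x (cons (and (head x) (head y)) (app .inter [tail x, tail y])) nil
  -- The difference of the subsets `x` and `y`.
  | .diff => let x := arg 0; let y := arg 1
      ite x (cons (and (head x) (not (head y))) (app .diff [tail x, tail y])) nil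
  -- The set of all elements of `S` below `p`.
  | .down => let M := arg 0; let S := arg 1; let p := arg 2
      app .inter [S, app .col [M, p]]
  -- The set of all elements of `S` above `p`.
  | .up => let M := arg 0; let S := arg 1; let p := arg 2
      app .inter [S, app .nth [M, p]]
  -- The set of all elements of the poset with matrix `M`.
  | .full => let M := arg 0
      ite M (cons tt (app .full [tail M])) nil
  -- Equality of trees.
  | .eq => let x := arg 0; let y := arg 1
      ite x
        (and y (and (app .eq [head x, head y]) (app .eq [tail x, tail y])))
        (not y)
  -- Membership of `x` in the list `l`.
  | .mem => let x := arg 0; let l := arg 1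
      ite l (or (app .eq [x, head l]) (app .mem [x, tail l])) nil
  -- Insertion of `x` into the list `l`, without creating a repetition.
  | .insert => let x := arg 0; let l := arg 1
      ite (app .mem [x, l]) l (cons x l)
  -- The family of all `X \ U` with `X` in the family `l`.
  | .removeAll => let l := arg 0; let U := arg 1
      ite l (app .insert [app .diff [head l, U], app .removeAll [tail l, U]]) nil
  -- The family of all `X` in the family `l` with `p ∈ X`.
  | .having => let l := arg 0; let p := arg 1
      ite l
        (ite (app .nth [head l, p])
          (cons (head l) (app .having [tail l, p]))
          (app .having [tail l, p]))
        nil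
  -- The family of all `X` in the family `l` with `p ∉ X`.
  | .lacking => let l := arg 0; let p := arg 1
      ite l
        (ite (app .nth [head l, p])
          (app .lacking [tail l, p])
          (cons (head l) (app .lacking [tail l, p])))
        nil
  -- The family of the complements `S \ X` with `X` in the family `l`.
  | .complement => let l := arg 0; let S := arg 1
      ite l (cons (app .diff [S, head l]) (app .complement [tail l, S])) nil
  -- The cardinality of the subset `x`.
  | .size => let x := arg 0
      ite x (ite (head x) (cons nil (app .size [tail x])) (app .size [tail x])) nil
  -- The length of the list `l`.
  | .length => let l := arg 0
      ite l (cons nil (app .length [tail l])) nil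
  -- The list of all elements of the subset `S`, where `i` is the element that the first entry of
  -- `S` stands for.
  | .elements => let S := arg 0; let i := arg 1
      ite S
        (ite (head S)
          (cons i (app .elements [tail S, cons nil i]))
          (app .elements [tail S, cons nil i]))
        nil
  -- Arithmetic of unary numbers: sum, product, strict order and maximum.
  | .add => let x := arg 0; let y := arg 1
      ite x (cons nil (app .add [tail x, y])) y
  | .mul => let x := arg 0; let y := arg 1
      ite x (app .add [y, app .mul [tail x, y]]) nil
  | .lt => let x := arg 0; let y := arg 1
      ite y (ite x (app .lt [tail x, tail y]) tt) nil
  | .max => let x := arg 0; let y := arg 1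
      ite (app .lt [x, y]) y x
  -- The sum of the binary numbers `x` and `y` and the carry bit `c`.
  | .addBin => let x := arg 0; let y := arg 1; let c := arg 2
      ite (or x y)
        (cons (xor (head x) (xor (head y) c))
          (app .addBin [tail x, tail y,
            ite (head x) (or (head y) c) (and (head y) c)]))
        (ite c (list [tt]) nil)
  -- The product of the unary number `k` and the binary number `x`.
  | .timesBin => let k := arg 0; let x := arg 1
      ite k (app .addBin [x, app .timesBin [tail k, x], nil]) nil
  -- `b ^ k * x` for unary numbers `k`, `b` and a binary number `x`.
  | .powTimesBin => let k := arg 0; let b := arg 1; let x := arg 2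
      ite k (app .timesBin [b, app .powTimesBin [tail k, b, x]]) x
  -- For binary numbers `x` and `y`: whether `x < y`, or, in case `x = y`, the truth value `c`.
  | .ltBin => let x := arg 0; let y := arg 1; let c := arg 2
      ite (or x y)
        (app .ltBin [tail x, tail y,
          ite (head x) (ite (head y) c nil) (ite (head y) tt c)])
        c
  -- `|↓p| + |↑p|`, computed in the subposet `S`.
  | .nbhd => let M := arg 0; let S := arg 1; let p := arg 2
      app .add [app .size [app .down [M, S, p]], app .size [app .up [M, S, p]]]
  -- The list of all pairs of `|↓p| + |↑p|` and `p`, with `p` in the list `l`.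
  | .withNbhd => let l := arg 0; let M := arg 1; let S := arg 2
      ite l
        (cons (cons (app .nbhd [M, S, head l]) (head l)) (app .withNbhd [tail l, M, S]))
        nil
  -- The larger one of the frequencies of `p` in the families `A` and `C`, multiplied by
  -- `|A| * |C|`.
  | .score => let A := arg 0; let C := arg 1; let p := arg 2
      app .max
        [app .mul [app .length [app .having [A, p]], app .length [C]],
         app .mul [app .length [app .having [C, p]], app .length [A]]]
  -- The list of all pairs of the score of `p` and `p`, with `p` in the list `l`.
  | .withScore => let l := arg 0; let A := arg 1; let C := arg 2
      ite l
        (cons (cons (app .score [A, C, head l]) (head l)) (app .withScore [tail l, A, C]))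
        nil
  -- The pair with the larger first component.
  | .better => let r := arg 0; let s := arg 1
      ite (app .lt [head r, head s]) s r
  -- In a list `l` of pairs, a pair with the largest first component.
  | .best => let l := arg 0
      ite (tail l) (app .better [head l, app .best [tail l]]) (head l)
  -- Whether the frequency `c / a` is less than `1 / (k * log_{4/3} N)`, that is, whether
  -- `N ^ (k * c) * 3 ^ a < 4 ^ a`.
  | .infrequent => let c := arg 0; let a := arg 1; let k := arg 2; let N := arg 3
      app .ltBin
        [app .powTimesBin [app .mul [k, c], N, app .powTimesBin [a, unary 3, list [tt]]],
         app .powTimesBin [a, unary 4, list [tt]],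
         nil]
  -- Whether all elements of the list `l` have a frequency in the family `C` that is less than
  -- `1 / (k * log_{4/3} N)`.
  | .allInfrequent => let l := arg 0; let C := arg 1; let k := arg 2; let N := arg 3
      ite l
        (and
          (app .infrequent [app .length [app .having [C, head l]], app .length [C], k, N])
          (app .allInfrequent [tail l, C, k, N]))
        tt
  -- Duality test in case that `A` or `B` is empty: if `A` is empty, then `S` must belong to `B`,
  -- and otherwise the empty set must belong to `A`.
  | .easyTest => let A := arg 0; let B := arg 1; let S := arg 2
      ite A (app .mem [app .diff [S, S], A]) (app .mem [S, B])
  -- The recursive duality test for `A` and `B` on the subposet `S`.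
  | .testDuality => let A := arg 0; let B := arg 1; let S := arg 2; let M := arg 3
      ite (and A B)
        (app .branchLarge
          [app .best [app .withNbhd [app .elements [S, nil], M, S]], A, B, S, M])
        (app .easyTest [A, B, S])
  -- Here `r` is the pair of `m` and an element `p` with `m = |↓p| + |↑p|` largest.  If
  -- `m > |S| ^ (1/3)`, then decompose with respect to `p`.
  | .branchLarge =>
      let r := arg 0; let A := arg 1; let B := arg 2; let S := arg 3; let M := arg 4
      let m := head r; let p := tail r
      ite (app .lt [app .size [S], app .mul [m, app .mul [m, m]]])
        (app .decompose [p, A, B, S, M])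
        (app .branchFrequent [m, app .complement [B, S], A, B, S, M])
  -- Here `C` is the family of the complements of the members of `B`.  If all frequencies in `A`
  -- are less than `1 / (m * log_{4/3} N)` and all frequencies in `C` are less than
  -- `1 / (m ^ 2 * log_{4/3} N)`, then answer "false", and otherwise decompose with respect to a
  -- most frequent element.
  | .branchFrequent =>
      let m := arg 0; let C := arg 1
      let A := arg 2; let B := arg 3; let S := arg 4; let M := arg 5
      let P := app .elements [S, nil]
      let N := app .add [app .length [A], app .length [B]]
      ite (and (app .allInfrequent [P, A, m, N])
            (app .allInfrequent [P, C, app .mul [m, m], N]))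
        nil
        (app .decompose [tail (app .best [app .withScore [P, A, C]]), A, B, S, M])
  -- The two recursive calls for the element `p`: on `S \ ↓p` with all `X \ ↓p`, `X ∈ A`, and all
  -- `Y \ ↓p`, `p ∈ Y ∈ B`, and on `S \ ↑p` with all `X ∈ A`, `p ∉ X`, and all `Y \ ↑p`, `Y ∈ B`.
  | .decompose =>
      let p := arg 0; let A := arg 1; let B := arg 2; let S := arg 3; let M := arg 4
      let D := app .down [M, S, p]
      let U := app .up [M, S, p]
      and
        (app .testDuality
          [app .removeAll [A, D], app .removeAll [app .having [B, p], D], app .diff [S, D], M])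
        (app .testDuality
          [app .lacking [A, p], app .removeAll [B, U], app .diff [S, U], M])
  -- The whole algorithm, on the input `A`, `B`, `M`.
  | .main => let A := arg 0; let B := arg 1; let M := arg 2
      app .testDuality [A, B, app .full [M], M]

/-! ### Encoding of the input -/

open Classical in
/-- The truth values of `q 0, …, q (n - 1)`. -/
noncomputable def encodePred {n : ℕ} (q : Fin n → Prop) : Tree :=
  Tree.ofList (List.ofFn fun i => Tree.ofBool (decide (q i)))

/-- The `n × n` matrix of the order of a poset with elements `e 0, …, e (n - 1)`. -/
noncomputable def encodePoset {P : Type*} [PartialOrder P] {n : ℕ} (e : Fin n ≃ P) : Tree :=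
  Tree.ofList (List.ofFn fun i => encodePred fun j => e i ≤ e j)

/-- A list of downsets, each given by its characteristic vector. -/
noncomputable def encodeDownsets {P : Type*} [PartialOrder P] {n : ℕ} (e : Fin n ≃ P)
    (A : List (LowerSet P)) : Tree :=
  Tree.ofList (A.map fun X => encodePred fun i => e i ∈ X)

/-- The input of the algorithm. -/
noncomputable def encodeInput {P : Type*} [PartialOrder P] {n : ℕ} (e : Fin n ≃ P)
    (A B : List (LowerSet P)) : Tree :=
  Tree.ofList [encodeDownsets e A, encodeDownsets e B, encodePoset e]

end TreeLang

/-!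
The recursion is correct because the downsets of a subposet `S` that contain an element `p`
correspond to the downsets of `S \ ↓p`, and those that do not contain `p` are the downsets of
`S \ ↑p` (`dualIn_iff_decompose`).

The answer "false" without recursion is correct by a probabilistic argument
(`not_dualIn_of_infrequent`).  Let `m` bound `|↓p| + |↑p|`, and suppose that the families are dual.
Every member of `A` meets the complement of every member of `B`; as no element is frequent, all
members of `A` and all these complements are large.  Select elements of `S` independently, such that
a set of `m` elements is avoided with probability `1 / 2`.  The downset generated by the selection
lies in a given `b ∈ B` only if the selection avoids `S \ b`.  It contains a given `a ∈ A` only if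
the selection meets the upset of each element of `a`; among these, there are at least `|a| / m ^ 2`
pairwise disjoint ones (`exists_disjoint_above`), which are met independently.  All of these
probabilities are less than `1 / (|A| + |B|)`, so some downset refutes duality.

For the number of recursive calls, the potential `depth`, essentially `3 s ^ (2/3) + 2 E log (|A|
|B| + 1)` with `s = |S|` and `E = n ^ (2/3) log_{4/3} N` for the initial values of `n` and `N =
|A| + |B|`, never increases along the recursion. It drops by one in at least one of the two
branches (`depth_le_of_goodPivot`), while `s` drops in both. If `|↓p| + |↑p| > s ^ (1/3)`, then
the first summand drops in the branch that removes the larger one of the two sets; otherwise the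
pivot `p` has frequency at least `1 / E` in `A` or in the family of the complements of the members
of `B`, and the second summand drops. Hence there are at most `2 (s + 1) ^ depth` calls
(`calls_recursion`). The work of a single call is polynomial in `n + |A| + |B|`
(`stepOutcome_testDuality`); this is obtained by a calculus of cost-bounded evaluations, `Ev`, in
which every function of the program is specified together with a bound on its running time.
Finally, the factor `log (n + 1)` in the exponent is absorbed by `n ^ (1/300)`, where `2/3 + 1/300
= 0.67` (`time_bound`).
-/

namespace TreeLang

open TreeLang.Tree TreeLang.Expr

/-! ### Cost-bounded evaluation -/

/-- In the program `code`, with argument `x`, the expression `e` evaluates to `v` within at most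
`T` steps. -/
def Ev (x : Tree) (e : Expr Fn) (v : Tree) (T : ℕ) : Prop :=
  ∃ t ≤ T, Evaluates code x e v t

/-- The function `f` of the program `code`, applied to the list `l` of arguments, returns `v` within
at most `T` steps. -/
abbrev Runs (f : Fn) (l : List Tree) (v : Tree) (T : ℕ) : Prop :=
  Ev (ofList l) (code f) v T

namespace Ev

variable {x a b c d a' b' v : Tree} {e e₁ e₂ e₃ e₄ e₅ e₆ : Expr Fn} {l : List Tree}
  {s t t₁ t₂ t₃ t₄ t₅ t₆ T T' : ℕ} {p q : Bool} {f : Fn}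

theorem mono (h : Ev x e v T) (hT : T ≤ T') : Ev x e v T' :=
  let ⟨t, ht, H⟩ := h
  ⟨t, ht.trans hT, H⟩

theorem inp : Ev x .input x 1 := ⟨1, le_rfl, .input x⟩

theorem nil : Ev x .nil .nil 1 := ⟨1, le_rfl, .nil x⟩

theorem cons (h₁ : Ev x e₁ a s) (h₂ : Ev x e₂ b t) : Ev x (.cons e₁ e₂) (.cons a b) (s + t + 1) :=
  let ⟨s', hs, H₁⟩ := h₁
  let ⟨t', ht, H₂⟩ := h₂
  ⟨s' + t' + 1, by omega, .cons H₁ H₂⟩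

theorem head (h : Ev x e a s) : Ev x (.head e) a.head (s + 1) :=
  let ⟨s', hs, H⟩ := h
  ⟨s' + 1, by omega, .head H⟩

theorem tail (h : Ev x e a s) : Ev x (.tail e) a.tail (s + 1) :=
  let ⟨s', hs, H⟩ := h
  ⟨s' + 1, by omega, .tail H⟩

theorem iteCons (h₁ : Ev x e₁ (.cons a b) s) (h₂ : Ev x e₂ v t) :
    Ev x (.ite e₁ e₂ e₃) v (s + t + 1) :=
  let ⟨s', hs, H₁⟩ := h₁
  let ⟨t', ht, H₂⟩ := h₂
  ⟨s' + t' + 1, by omega, .iteTrue H₁ H₂⟩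

theorem iteNil (h₁ : Ev x e₁ .nil s) (h₂ : Ev x e₃ v t) :
    Ev x (.ite e₁ e₂ e₃) v (s + t + 1) :=
  let ⟨s', hs, H₁⟩ := h₁
  let ⟨t', ht, H₂⟩ := h₂
  ⟨s' + t' + 1, by omega, .iteFalse H₁ H₂⟩

theorem iteBool (h₁ : Ev x e₁ (ofBool p) s) (h₂ : p = true → Ev x e₂ v t)
    (h₃ : p = false → Ev x e₃ v t) : Ev x (.ite e₁ e₂ e₃) v (s + t + 1) := by
  cases p
  · exact iteNil h₁ (h₃ rfl)
  · exact iteCons h₁ (h₂ rfl)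

theorem call (h₁ : Ev x e a s) (h₂ : Ev a (code f) v t) : Ev x (.call f e) v (s + t + 1) :=
  let ⟨s', hs, H₁⟩ := h₁
  let ⟨t', ht, H₂⟩ := h₂
  ⟨s' + t' + 1, by omega, .call H₁ H₂⟩

theorem tt : Ev x Expr.tt (ofBool true) 3 := cons nil nil

theorem ff : Ev x .nil (ofBool false) 1 := nil

theorem not (h : Ev x e (ofBool p) s) : Ev x (Expr.not e) (ofBool !p) (s + 4) :=
  (iteBool (t := 3) h (by rintro rfl; exact nil.mono (by omega))
    (by rintro rfl; exact tt)).mono (by omega)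

theorem and (h₁ : Ev x e₁ (ofBool p) s) (h₂ : p = true → Ev x e₂ (ofBool q) t) :
    Ev x (Expr.and e₁ e₂) (ofBool (p && q)) (s + t + 2) :=
  (iteBool (t := t + 1) h₁ (by rintro rfl; exact (h₂ rfl).mono (by omega))
    (by rintro rfl; exact nil.mono (by omega))).mono (by omega)

theorem or (h₁ : Ev x e₁ (ofBool p) s) (h₂ : p = false → Ev x e₂ (ofBool q) t) :
    Ev x (Expr.or e₁ e₂) (ofBool (p || q)) (s + t + 4) :=
  (iteBool (t := t + 3) h₁ (by rintro rfl; exact tt.mono (by omega))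
    (by rintro rfl; exact (h₂ rfl).mono (by omega))).mono (by omega)

theorem xor (h₁ : Ev x e₁ (ofBool p) s) (h₂ : Ev x e₂ (ofBool q) t) :
    Ev x (Expr.xor e₁ e₂) (ofBool (p ^^ q)) (s + t + 5) :=
  (iteBool (t := t + 4) h₁ (by rintro rfl; simpa using h₂.not)
    (by rintro rfl; simpa using h₂.mono (by omega))).mono (by omega)

theorem arg0 : Ev (ofList (a :: l)) (arg 0) a 2 := head inp

theorem arg1 : Ev (ofList (a :: b :: l)) (arg 1) b 3 := head (tail inp)

theorem arg2 : Ev (ofList (a :: b :: c :: l)) (arg 2) c 4 := head (tail (tail inp))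

theorem arg3 : Ev (ofList (a :: b :: c :: d :: l)) (arg 3) d 5 := head (tail (tail (tail inp)))

theorem arg4 : Ev (ofList (a :: b :: c :: d :: a' :: l)) (arg 4) a' 6 :=
  head (tail (tail (tail (tail inp))))

theorem arg5 : Ev (ofList (a :: b :: c :: d :: a' :: b' :: l)) (arg 5) b' 7 :=
  head (tail (tail (tail (tail (tail inp)))))

theorem app1 (h₁ : Ev x e₁ a t₁) (h : Runs f [a] v t) :
    Ev x (app f [e₁]) v (t₁ + t + 3) :=
  (call (cons h₁ nil) h).mono (by omega)

theorem app2 (h₁ : Ev x e₁ a t₁) (h₂ : Ev x e₂ b t₂) (h : Runs f [a, b] v t) :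
    Ev x (app f [e₁, e₂]) v (t₁ + t₂ + t + 4) :=
  (call (cons h₁ (cons h₂ nil)) h).mono (by omega)

theorem app3 (h₁ : Ev x e₁ a t₁) (h₂ : Ev x e₂ b t₂) (h₃ : Ev x e₃ c t₃)
    (h : Runs f [a, b, c] v t) : Ev x (app f [e₁, e₂, e₃]) v (t₁ + t₂ + t₃ + t + 5) :=
  (call (cons h₁ (cons h₂ (cons h₃ nil))) h).mono (by omega)

theorem app4 (h₁ : Ev x e₁ a t₁) (h₂ : Ev x e₂ b t₂) (h₃ : Ev x e₃ c t₃) (h₄ : Ev x e₄ d t₄)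
    (h : Runs f [a, b, c, d] v t) :
    Ev x (app f [e₁, e₂, e₃, e₄]) v (t₁ + t₂ + t₃ + t₄ + t + 6) :=
  (call (cons h₁ (cons h₂ (cons h₃ (cons h₄ nil)))) h).mono (by omega)

theorem app5 (h₁ : Ev x e₁ a t₁) (h₂ : Ev x e₂ b t₂) (h₃ : Ev x e₃ c t₃) (h₄ : Ev x e₄ d t₄)
    (h₅ : Ev x e₅ a' t₅) (h : Runs f [a, b, c, d, a'] v t) :
    Ev x (app f [e₁, e₂, e₃, e₄, e₅]) v (t₁ + t₂ + t₃ + t₄ + t₅ + t + 7) :=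
  (call (cons h₁ (cons h₂ (cons h₃ (cons h₄ (cons h₅ nil))))) h).mono (by omega)

theorem app6 (h₁ : Ev x e₁ a t₁) (h₂ : Ev x e₂ b t₂) (h₃ : Ev x e₃ c t₃) (h₄ : Ev x e₄ d t₄)
    (h₅ : Ev x e₅ a' t₅) (h₆ : Ev x e₆ b' t₆) (h : Runs f [a, b, c, d, a', b'] v t) :
    Ev x (app f [e₁, e₂, e₃, e₄, e₅, e₆]) v (t₁ + t₂ + t₃ + t₄ + t₅ + t₆ + t + 8) :=
  (call (cons h₁ (cons h₂ (cons h₃ (cons h₄ (cons h₅ (cons h₆ nil)))))) h).mono (by omega)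

end Ev

/-! ### Lists and sets as trees -/

/-- The unary number `k`: a list of `k` atoms. -/
def num : ℕ → Tree
  | 0 => .nil
  | k + 1 => .cons .nil (num k)

/-- The list of the values of `f`. -/
def ofFn {n : ℕ} (f : Fin n → Tree) : Tree := ofList (List.ofFn f)

theorem ofFn_zero (f : Fin 0 → Tree) : ofFn f = .nil := by simp [ofFn, ofList]

theorem ofFn_succ {n : ℕ} (f : Fin (n + 1) → Tree) :
    ofFn f = .cons (f 0) (ofFn fun i => f i.succ) := by
  simp [ofFn, ofList, List.ofFn_succ]

theorem encodePred_zero (q : Fin 0 → Prop) : encodePred q = .nil := ofFn_zero _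

open Classical in
theorem encodePred_succ {n : ℕ} (q : Fin (n + 1) → Prop) :
    encodePred q = .cons (ofBool (decide (q 0))) (encodePred fun i => q i.succ) := ofFn_succ _

theorem ofBool_injective : Function.Injective ofBool := by
  intro a b h
  cases a <;> cases b <;> simp_all [ofBool]

theorem runs_nth {n : ℕ} (f : Fin n → Tree) (i : Fin n) :
    Runs .nth [ofFn f, num i] (f i) (20 * (i + 1)) := by
  induction n with
  | zero => exact i.elim0
  | succ n ih =>
    rw [ofFn_succ]
    refine Fin.cases ?_ (fun i => ?_) i
    · exact (Ev.iteNil .arg1 (.head .arg0)).mono (by simp)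
    · exact (Ev.iteCons .arg1 (.app2 (.tail .arg0) (.tail .arg1) (ih _ i))).mono
        (by simp only [Fin.val_succ]; omega)

theorem runs_col {n k : ℕ} (f : Fin k → Fin n → Tree) (i : Fin n) :
    Runs .col [ofFn fun j => ofFn (f j), num i] (ofFn fun j => f j i)
      ((k + 1) * (20 * i + 60)) := by
  induction k with
  | zero =>
    simp only [ofFn_zero]
    exact (Ev.iteNil .arg0 .nil).mono (by omega)
  | succ k ih =>
    rw [ofFn_succ, ofFn_succ]
    exact (Ev.iteCons .arg0 (.cons (.app2 (.head .arg0) .arg1 (runs_nth _ i))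
      (.app2 (.tail .arg0) .arg1 (ih _)))).mono (by linarith)

open Classical in
theorem runs_inter {n : ℕ} (p q : Fin n → Prop) :
    Runs .inter [encodePred p, encodePred q] (encodePred fun i => p i ∧ q i) (40 * (n + 1)) := by
  induction n with
  | zero =>
    simp only [encodePred_zero]
    exact (Ev.iteNil .arg0 .nil).mono (by omega)
  | succ k ih =>
    simp only [encodePred_succ, Bool.decide_and]
    exact (Ev.iteCons .arg0 (.cons (.and (.head .arg0) fun _ => .head .arg1)
      (.app2 (.tail .arg0) (.tail .arg1) (ih _ _)))).mono (by omega)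

open Classical in
theorem runs_diff {n : ℕ} (p q : Fin n → Prop) :
    Runs .diff [encodePred p, encodePred q] (encodePred fun i => p i ∧ ¬ q i) (40 * (n + 1)) := by
  induction n with
  | zero =>
    simp only [encodePred_zero]
    exact (Ev.iteNil .arg0 .nil).mono (by omega)
  | succ k ih =>
    simp only [encodePred_succ, Bool.decide_and, decide_not]
    exact (Ev.iteCons .arg0 (.cons (.and (.head .arg0) fun _ => .not (.head .arg1))
      (.app2 (.tail .arg0) (.tail .arg1) (ih _ _)))).mono (by omega)

theorem runs_full {n : ℕ} (f : Fin n → Tree) :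
    Runs .full [ofFn f] (encodePred fun _ : Fin n => True) (20 * (n + 1)) := by
  induction n with
  | zero =>
    simp only [ofFn_zero, encodePred_zero]
    exact (Ev.iteNil .arg0 .nil).mono (by omega)
  | succ k ih =>
    simp only [ofFn_succ, encodePred_succ, decide_true]
    exact (Ev.iteCons .arg0 (.cons .tt (.app1 (.tail .arg0) (ih _)))).mono (by omega)

/-- The number of nodes of a tree. -/
def Tree.nodes : Tree → ℕ
  | .nil => 1
  | .cons a b => a.nodes + b.nodes + 1

theorem nodes_encodePred {n : ℕ} (q : Fin n → Prop) : (encodePred q).nodes ≤ 4 * n + 1 := by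
  classical
  induction n with
  | zero => simp [encodePred_zero, Tree.nodes]
  | succ n ih =>
    have := ih fun i => q i.succ
    rw [encodePred_succ]
    cases decide (q 0) <;> simp [Tree.nodes, ofBool] <;> omega

open Classical in
theorem runs_eq (x y : Tree) : Runs .eq [x, y] (ofBool (decide (x = y))) (40 * x.nodes) := by
  induction x generalizing y with
  | nil =>
    cases y with
    | nil =>
      rw [decide_eq_true rfl]
      exact (Ev.iteNil .arg0 (.iteNil .arg1 .tt)).mono (by simp [Tree.nodes])
    | cons c d =>
      rw [decide_eq_false (by simp)]
      exact (Ev.iteNil .arg0 (.iteCons .arg1 .ff)).mono (by simp [Tree.nodes])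
  | cons a b iha ihb =>
    cases y with
    | nil =>
      rw [decide_eq_false (by simp)]
      exact (Ev.iteCons .arg0 (.iteNil .arg1 .ff)).mono (by simp [Tree.nodes]; omega)
    | cons c d =>
      simp only [Tree.cons.injEq, Bool.decide_and]
      exact (Ev.iteCons .arg0 (.iteCons .arg1
        (.and (.app2 (.head .arg0) (.head .arg1) (iha c))
          fun _ => .app2 (.tail .arg0) (.tail .arg1) (ihb d)))).mono
        (by simp [Tree.nodes]; omega)

open Classical in
theorem runs_mem (x : Tree) (l : List Tree) :
    Runs .mem [x, ofList l] (ofBool (decide (x ∈ l))) ((l.length + 1) * (40 * x.nodes + 40)) := by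
  induction l with
  | nil =>
    rw [decide_eq_false (by simp)]
    exact (Ev.iteNil .arg1 .ff).mono (by simp)
  | cons y l ih =>
    simp only [List.mem_cons, Bool.decide_or]
    exact (Ev.iteCons .arg1 (.or (.app2 .arg0 (.head .arg1) (runs_eq x y))
      fun _ => .app2 .arg0 (.tail .arg1) ih)).mono (by simp only [List.length_cons]; linarith)

open Classical in
theorem runs_insert (x : Tree) (l : List Tree) :
    Runs .insert [x, ofList l] (ofList (if x ∈ l then l else x :: l))
      ((l.length + 1) * (40 * x.nodes + 40) + 30) :=
  (Ev.iteBool (t := 6) (.app2 .arg0 .arg1 (runs_mem x l))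
    (fun h => by rw [if_pos (by simpa using h)]; exact Ev.arg1.mono (by omega))
    (fun h => by rw [if_neg (by simpa using h)]; exact (Ev.cons .arg0 .arg1))).mono (by omega)

theorem runs_length (l : List Tree) :
    Runs .length [ofList l] (num l.length) (20 * (l.length + 1)) := by
  induction l with
  | nil => exact (Ev.iteNil .arg0 .nil).mono (by simp)
  | cons y l ih =>
    exact (Ev.iteCons .arg0 (.cons .nil (.app1 (.tail .arg0) ih))).mono
      (by simp only [List.length_cons]; omega)

theorem runs_size {n : ℕ} (q : Fin n → Prop) [DecidablePred q] :
    Runs .size [encodePred q] (num (Finset.univ.filter q).card) (30 * (n + 1)) := by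
  induction n with
  | zero =>
    simp only [encodePred_zero]
    exact (Ev.iteNil .arg0 .nil).mono (by omega)
  | succ k ih =>
    rw [encodePred_succ, Fin.card_filter_univ_succ]
    refine (Ev.iteCons .arg0 (.iteBool (t := 30 * (k + 1) + 20) (.head .arg0) (fun h => ?_)
      fun h => ?_)).mono (by omega)
    · rw [if_pos (by simpa using h)]
      exact (Ev.cons .nil (.app1 (.tail .arg0) (ih _))).mono (by omega)
    · rw [if_neg (by simpa using h)]
      exact (Ev.app1 (.tail .arg0) (ih _)).mono (by omega)

theorem runs_elements {n : ℕ} (q : Fin n → Prop) [DecidablePred q] (i : ℕ) :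
    Runs .elements [encodePred q, num i]
      (ofList (((List.finRange n).filter q).map fun j : Fin n => num (j + i))) (40 * (n + 1)) := by
  induction n generalizing i with
  | zero =>
    simp only [encodePred_zero]
    exact (Ev.iteNil .arg0 .nil).mono (by omega)
  | succ k ih =>
    have ih := ih (fun i => q i.succ) (i + 1)
    have h : ((List.finRange k).filter fun j => q j.succ).map (fun j : Fin k => num (j + (i + 1))) =
        (((List.finRange k).map Fin.succ).filter q).map fun j : Fin (k + 1) => num (j + i) := by
      simp only [List.filter_map, List.map_map]
      refine List.map_congr_left fun j _ => ?_
      simp only [Function.comp_apply, Fin.val_succ]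
      congr 1
      omega
    rw [h] at ih
    rw [encodePred_succ, List.finRange_succ]
    refine (Ev.iteCons .arg0 (.iteBool (t := 40 * (k + 1) + 30) (.head .arg0) (fun h => ?_)
      fun h => ?_)).mono (by omega)
    · rw [List.filter_cons, if_pos (by simpa using h)]
      simp only [List.map_cons, Fin.val_zero, zero_add]
      exact (Ev.cons .arg1 (.app2 (.tail .arg0) (.cons .nil .arg1) ih)).mono (by omega)
    · rw [List.filter_cons, if_neg (by simpa using h)]
      exact (Ev.app2 (.tail .arg0) (.cons .nil .arg1) ih).mono (by omega)

/-! ### Unary and binary arithmetic -/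

theorem runs_add (a b : ℕ) : Runs .add [num a, num b] (num (a + b)) (20 * (a + 1)) := by
  induction a with
  | zero =>
    rw [Nat.zero_add]
    exact (Ev.iteNil .arg0 .arg1).mono (by omega)
  | succ a ih =>
    rw [Nat.succ_add]
    exact (Ev.iteCons .arg0 (.cons .nil (.app2 (.tail .arg0) .arg1 ih))).mono (by omega)

theorem runs_mul (a b : ℕ) :
    Runs .mul [num a, num b] (num (a * b)) ((a + 1) * (20 * b + 50)) := by
  induction a with
  | zero =>
    rw [Nat.zero_mul]
    exact (Ev.iteNil .arg0 .nil).mono (by omega)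
  | succ a ih =>
    rw [Nat.succ_mul, Nat.add_comm _ b]
    exact (Ev.iteCons .arg0 (.app2 .arg1 (.app2 (.tail .arg0) .arg1 ih) (runs_add _ _))).mono
      (by linarith)

theorem runs_lt (a b : ℕ) :
    Runs .lt [num a, num b] (ofBool (decide (a < b))) (30 * (b + 1)) := by
  induction b generalizing a with
  | zero =>
    rw [decide_eq_false (by simp)]
    exact (Ev.iteNil .arg1 .ff).mono (by omega)
  | succ b ih =>
    cases a with
    | zero =>
      rw [decide_eq_true (by simp)]
      exact (Ev.iteCons .arg1 (.iteNil .arg0 .tt)).mono (by omega)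
    | succ a =>
      simp only [Nat.add_lt_add_iff_right]
      exact (Ev.iteCons .arg1 (.iteCons .arg0 (.app2 (.tail .arg0) (.tail .arg1) (ih a)))).mono
        (by omega)

theorem runs_max (a b : ℕ) :
    Runs .max [num a, num b] (num (max a b)) (30 * (b + 1) + 20) := by
  refine (Ev.iteBool (t := 3) (.app2 .arg0 .arg1 (runs_lt a b)) (fun h => ?_)
    fun h => ?_).mono (by omega)
  · rw [max_eq_right (of_decide_eq_true h).le]
    exact .arg1
  · rw [max_eq_left (not_lt.1 (of_decide_eq_false h))]
    exact Ev.arg0.mono (by omega)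

/-- The list of bits `x` as a binary number of the program. -/
def bin (x : List Bool) : Tree := ofList (x.map ofBool)

/-- The value of a binary number, whose least significant bit comes first. -/
def binVal : List Bool → ℕ
  | [] => 0
  | b :: x => b.toNat + 2 * binVal x

theorem head_bin (x : List Bool) : (bin x).head = ofBool (x.headD false) := by
  cases x <;> rfl

theorem tail_bin (x : List Bool) : (bin x).tail = bin x.tail := by
  cases x <;> rfl

theorem binVal_eq (x : List Bool) : binVal x = (x.headD false).toNat + 2 * binVal x.tail := by
  cases x <;> rfl

/-- The disjunction of two binary numbers, as trees, tells whether any bits are left. -/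
theorem ev_or_bin (x y : List Bool) (l : List Tree) (h : ¬ (x = [] ∧ y = [])) :
    ∃ a b, Ev (ofList (bin x :: bin y :: l)) (Expr.or (arg 0) (arg 1)) (.cons a b) 6 := by
  cases x with
  | nil =>
    cases y with
    | nil => simp at h
    | cons b y => exact ⟨_, _, .iteNil .arg0 .arg1⟩
  | cons a x => exact ⟨_, _, .iteCons .arg0 .tt⟩

theorem ev_or_bin_nil (l : List Tree) :
    Ev (ofList (bin [] :: bin [] :: l)) (Expr.or (arg 0) (arg 1)) .nil 6 :=
  .iteNil .arg0 .arg1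

theorem runs_addBin_nil (c : Bool) (n : ℕ) :
    ∃ z, binVal z = binVal [] + binVal [] + c.toNat ∧ z.length ≤ n + 1 ∧
      Runs .addBin [bin [], bin [], ofBool c] (bin z) (80 * (n + 1)) := by
  cases c
  · exact ⟨[], rfl, by simp, (Ev.iteNil (ev_or_bin_nil _) (.iteNil .arg2 .nil)).mono (by omega)⟩
  · exact ⟨[true], rfl, by simp,
      (Ev.iteNil (ev_or_bin_nil _) (.iteCons .arg2 (.cons .tt .nil))).mono (by omega)⟩

/-- The numeral of the sum may have leading zeros; its length is bounded only for the sake of the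
running time of later steps. -/
theorem runs_addBin (x y : List Bool) (c : Bool) (n : ℕ) (hx : x.length ≤ n) (hy : y.length ≤ n) :
    ∃ z, binVal z = binVal x + binVal y + c.toNat ∧ z.length ≤ n + 1 ∧
      Runs .addBin [bin x, bin y, ofBool c] (bin z) (80 * (n + 1)) := by
  by_cases h : x = [] ∧ y = []
  · obtain ⟨rfl, rfl⟩ := h
    exact runs_addBin_nil c n
  · induction n generalizing x y c with
    | zero => simp_all
    | succ n ih =>
      obtain ⟨a, b, hab⟩ := ev_or_bin x y [ofBool c] h
      set x₀ := x.headD false with hx₀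
      set y₀ := y.headD false with hy₀
      let c' := if x₀ then y₀ || c else y₀ && c
      have key : ∃ z, binVal z = binVal x.tail + binVal y.tail + c'.toNat ∧ z.length ≤ n + 1 ∧
          Runs .addBin [bin x.tail, bin y.tail, ofBool c'] (bin z) (80 * (n + 1)) := by
        by_cases h' : x.tail = [] ∧ y.tail = []
        · rw [h'.1, h'.2]
          exact runs_addBin_nil c' n
        · exact ih _ _ _ (by simpa using hx) (by simpa using hy) h'
      obtain ⟨z, hz, hl, hr⟩ := key
      have hX : Ev (ofList [bin x, bin y, ofBool c]) (.head (arg 0)) (ofBool x₀) 3 := by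
        rw [hx₀, ← head_bin]
        exact .head .arg0
      have hY : Ev (ofList [bin x, bin y, ofBool c]) (.head (arg 1)) (ofBool y₀) 4 := by
        rw [hy₀, ← head_bin]
        exact .head .arg1
      rw [← tail_bin, ← tail_bin] at hr
      refine ⟨(x₀ ^^ (y₀ ^^ c)) :: z, ?_, by simpa using hl,
        (Ev.iteCons hab (.cons (.xor hX (.xor hY .arg2)) (.app3 (.tail .arg0) (.tail .arg1)
          (.iteBool (t := 12) hX (fun h => ?_) (fun h => ?_)) hr))).mono (by omega)⟩
      · rw [binVal_eq x, binVal_eq y, binVal, hz, ← hx₀, ← hy₀]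
        simp only [c']
        cases x₀ <;> cases y₀ <;> cases c <;> simp <;> omega
      · simp only [c', h, if_true]
        exact (Ev.or hY fun _ => .arg2).mono (by omega)
      · simp only [c', h]
        exact (Ev.and hY fun _ => .arg2).mono (by omega)

theorem runs_timesBin (k : ℕ) (x : List Bool) :
    ∃ z, binVal z = k * binVal x ∧ z.length ≤ x.length + k ∧
      Runs .timesBin [num k, bin x] (bin z) ((k + 1) * (80 * (x.length + k) + 40)) := by
  induction k with
  | zero => exact ⟨[], by simp [binVal], by simp, (Ev.iteNil .arg0 .nil).mono (by omega)⟩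
  | succ k ih =>
    obtain ⟨z, hz, hl, hr⟩ := ih
    obtain ⟨w, hw, hl', hr'⟩ := runs_addBin x z false (x.length + k) (by omega) hl
    refine ⟨w, by rw [hw, hz, Bool.toNat_false]; ring, by omega,
      (Ev.iteCons .arg0 (.app3 .arg1 (.app2 (.tail .arg0) .arg1 hr) .nil hr')).mono ?_⟩
    nlinarith

theorem runs_powTimesBin (k b : ℕ) (x : List Bool) (L : ℕ) (hL : x.length + k * b ≤ L) :
    ∃ z, binVal z = b ^ k * binVal x ∧ z.length ≤ x.length + k * b ∧
      Runs .powTimesBin [num k, num b, bin x] (bin z)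
        ((k + 1) * ((b + 1) * (80 * L + 80))) := by
  induction k with
  | zero => exact ⟨x, by simp, by simp, (Ev.iteNil .arg0 .arg2).mono (by nlinarith)⟩
  | succ k ih =>
    obtain ⟨z, hz, hl, hr⟩ := ih (by linarith)
    obtain ⟨w, hw, hl', hr'⟩ := runs_timesBin b z
    refine ⟨w, by rw [hw, hz]; ring, by linarith,
      (Ev.iteCons .arg0 (.app2 .arg1 (.app3 (.tail .arg0) .arg1 .arg2 hr) hr')).mono ?_⟩
    have : (b + 1) * (80 * (z.length + b) + 40) ≤ (b + 1) * (80 * L + 40) := by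
      gcongr
      linarith
    nlinarith

theorem runs_ltBin (x y : List Bool) (c : Bool) (n : ℕ) (hx : x.length ≤ n) (hy : y.length ≤ n) :
    Runs .ltBin [bin x, bin y, ofBool c]
      (ofBool (decide (binVal x < binVal y ∨ binVal x = binVal y ∧ c = true))) (80 * (n + 1)) := by
  induction n generalizing x y c with
  | zero =>
    obtain rfl : x = [] := by simpa using hx
    obtain rfl : y = [] := by simpa using hy
    simp only [lt_self_iff_false, true_and, false_or, Bool.decide_eq_true]
    exact (Ev.iteNil (ev_or_bin_nil _) .arg2).mono (by omega)
  | succ n ih =>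
    by_cases h : x = [] ∧ y = []
    · obtain ⟨rfl, rfl⟩ := h
      simp only [lt_self_iff_false, true_and, false_or, Bool.decide_eq_true]
      exact (Ev.iteNil (ev_or_bin_nil _) .arg2).mono (by omega)
    · obtain ⟨a, b, hab⟩ := ev_or_bin x y [ofBool c] h
      set x₀ := x.headD false with hx₀
      set y₀ := y.headD false with hy₀
      let c' := if x₀ then y₀ && c else y₀ || c
      have hr := ih x.tail y.tail c' (by simpa using hx) (by simpa using hy)
      have hX : Ev (ofList [bin x, bin y, ofBool c]) (.head (arg 0)) (ofBool x₀) 3 := by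
        rw [hx₀, ← head_bin]
        exact .head .arg0
      have hY : Ev (ofList [bin x, bin y, ofBool c]) (.head (arg 1)) (ofBool y₀) 4 := by
        rw [hy₀, ← head_bin]
        exact .head .arg1
      rw [← tail_bin, ← tail_bin] at hr
      have hv : (binVal x < binVal y ∨ binVal x = binVal y ∧ c = true) ↔
          (binVal x.tail < binVal y.tail ∨ binVal x.tail = binVal y.tail ∧ c' = true) := by
        rw [binVal_eq x, binVal_eq y, ← hx₀, ← hy₀]
        simp only [c']
        cases x₀ <;> cases y₀ <;> cases c <;> simp <;> omega
      rw [decide_eq_decide.2 hv]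
      refine (Ev.iteCons hab (.app3 (.tail .arg0) (.tail .arg1)
          (.iteBool (t := 12) hX (fun h => ?_) (fun h => ?_)) hr)).mono (by omega)
      · simp only [c', h, if_true]
        exact (Ev.and hY fun _ => .arg2).mono (by omega)
      · simp only [c', h]
        exact (Ev.or hY fun _ => .arg2).mono (by omega)

/-- If `K` bounds all quantities, then the numerals that occur have at most `K ^ 5` bits. -/
theorem runs_infrequent (c a k N K : ℕ) (hK : 100 ≤ K) (hc : c ≤ K) (ha : a ≤ K)
    (hk : k ≤ K ^ 2) (hN : N ≤ K) :
    Runs .infrequent [num c, num a, num k, num N]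
      (ofBool (decide (N ^ (k * c) * 3 ^ a < 4 ^ a))) (K ^ 11) := by
  have hkc : k * c ≤ K ^ 3 := by
    calc k * c ≤ K ^ 2 * K := by gcongr
      _ = K ^ 3 := by ring
  have hkcN : k * c * N ≤ K ^ 4 := by
    calc k * c * N ≤ K ^ 3 * K := by gcongr
      _ = K ^ 4 := by ring
  have h1 : 1 + 3 * K + K ^ 4 ≤ K ^ 5 := by
    obtain ⟨j, rfl⟩ := Nat.exists_eq_add_of_le hK
    ring_nf
    omega
  have h2 : 4 * K + 1 ≤ K ^ 5 := by
    obtain ⟨j, rfl⟩ := Nat.exists_eq_add_of_le hK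
    ring_nf
    omega
  have h3 : 1 + K ≤ K ^ 5 := by omega
  have hone : [true].length = 1 := rfl
  obtain ⟨x, hx, hl, hr⟩ := runs_powTimesBin a 3 [true] (K ^ 5)
    (by omega)
  obtain ⟨y, hy, hl', hr'⟩ := runs_powTimesBin (k * c) N x (K ^ 5)
    (by omega)
  obtain ⟨z, hz, hl'', hr''⟩ := runs_powTimesBin a 4 [true] (K ^ 5)
    (by omega)
  have hlt := runs_ltBin y z false (K ^ 5)
    (by omega)
    (by omega)
  rw [hy, hz, hx] at hlt
  simp only [binVal, Bool.toNat_true, mul_zero, add_zero, mul_one, Bool.false_eq_true,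
    and_false, or_false] at hlt
  have e3 : ∀ x, Ev x (unary 3) (num 3) 10 := fun x =>
    Ev.mono (.cons .nil (.cons .nil (.cons .nil .nil))) (by omega)
  have e4 : ∀ x, Ev x (unary 4) (num 4) 10 := fun x =>
    Ev.mono (.cons .nil (.cons .nil (.cons .nil (.cons .nil .nil)))) (by omega)
  have e1 : ∀ x, Ev x (list [tt]) (bin [true]) 10 := fun x =>
    Ev.mono (.cons .tt .nil) (by omega)
  refine Ev.mono (.app3 (.app3 (.app2 .arg2 .arg0 (runs_mul k c)) .arg3
    (.app3 .arg1 (e3 _) (e1 _) hr) hr') (.app3 .arg1 (e4 _) (e1 _) hr'') .nil hlt) ?_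
  have b1 : (k + 1) * (20 * c + 50) ≤ (K ^ 2 + 1) * (20 * K + 50) := by gcongr
  have b2 : (a + 1) * ((3 + 1) * (80 * K ^ 5 + 80)) ≤ (K + 1) * (4 * (80 * K ^ 5 + 80)) := by gcongr
  have b3 : (a + 1) * ((4 + 1) * (80 * K ^ 5 + 80)) ≤ (K + 1) * (5 * (80 * K ^ 5 + 80)) := by gcongr
  have b4 : (k * c + 1) * ((N + 1) * (80 * K ^ 5 + 80)) ≤
      (K ^ 3 + 1) * ((K + 1) * (80 * K ^ 5 + 80)) := by gcongr
  have b5 : (K ^ 2 + 1) * (20 * K + 50) + (K + 1) * (4 * (80 * K ^ 5 + 80)) +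
    (K + 1) * (5 * (80 * K ^ 5 + 80)) + (K ^ 3 + 1) * ((K + 1) * (80 * K ^ 5 + 80)) +
    80 * (K ^ 5 + 1) + 200 ≤ K ^ 11 := by
    obtain ⟨j, rfl⟩ := Nat.exists_eq_add_of_le hK
    ring_nf
    omega
  omega

/-! ### Maxima in lists of pairs -/

/-- The pair of a score and an object, the latter encoded by `g`. -/
def pair {P : Type*} (g : P → Tree) (r : ℕ × P) : Tree := .cons (num r.1) (g r.2)

/-- The function `best` returns a pair from the list whose score is maximal. -/
theorem runs_best {P : Type*} (g : P → Tree) (B : ℕ) (l : List (ℕ × P)) (hl : l ≠ [])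
    (hB : ∀ r ∈ l, r.1 ≤ B) :
    ∃ r ∈ l, (∀ s ∈ l, s.1 ≤ r.1) ∧
      Runs .best [ofList (l.map (pair g))] (pair g r) ((l.length + 1) * (30 * B + 100)) := by
  induction l with
  | nil => simp at hl
  | cons r l ih =>
    cases l with
    | nil => exact ⟨r, by simp, by simp,
        (Ev.iteNil (.tail .arg0) (.head .arg0)).mono (by simp; omega)⟩
    | cons r' l =>
      obtain ⟨s, hs, hmax, hrun⟩ := ih (by simp) fun x hx => hB x (List.mem_cons_of_mem _ hx)
      have hlt : Runs .lt [(pair g r).head, (pair g s).head] (ofBool (decide (r.1 < s.1)))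
          (30 * (B + 1)) :=
        (runs_lt r.1 s.1).mono (by have := hB s (List.mem_cons_of_mem _ hs); omega)
      have hbetter : Runs .better [pair g r, pair g s] (pair g (if r.1 < s.1 then s else r))
          (30 * B + 60) := by
        refine (Ev.iteBool (t := 3) (.app2 (.head .arg0) (.head .arg1) hlt) (fun h => ?_)
          fun h => ?_).mono (by omega)
        · rw [if_pos (of_decide_eq_true h)]
          exact .arg1
        · rw [if_neg (of_decide_eq_false h)]
          exact Ev.arg0.mono (by omega)
      refine ⟨if r.1 < s.1 then s else r, ?_, ?_, (Ev.iteCons (.tail .arg0)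
        (.app2 (.head .arg0) (.app1 (.tail .arg0) hrun) hbetter)).mono ?_⟩
      · split_ifs
        · exact List.mem_cons_of_mem _ hs
        · simp
      · intro x hx
        rcases List.mem_cons.1 hx with rfl | hx
        · split_ifs <;> omega
        · have := hmax x hx
          split_ifs <;> omega
      · simp only [List.length_cons]
        linarith

theorem runs_best_nil : Runs .best [.nil] .nil 10 :=
  (Ev.iteNil (.tail .arg0) (.head .arg0)).mono (by omega)

/-! ### Subsets of the poset -/

section Sets

open scoped Classical

variable {P : Type*} {n : ℕ} (e : Fin n ≃ P)

/-- The characteristic vector of `X`. -/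
noncomputable def enc (X : Finset P) : Tree := encodePred fun i => e i ∈ X

/-- The list of the characteristic vectors of the members of `A`. -/
noncomputable def fam (A : List (Finset P)) : Tree := ofList (A.map (enc e))

/-- The index of an element of the poset, as a unary number. -/
def idx (p : P) : Tree := num (e.symm p)

/-- The elements of `S`, in the order of their indices. -/
noncomputable def elems (S : Finset P) : List P :=
  ((List.finRange n).filter fun i => e i ∈ S).map e

theorem mem_elems {S : Finset P} {p : P} : p ∈ elems e S ↔ p ∈ S := by
  simp only [elems, List.mem_map, List.mem_filter, List.mem_finRange, true_and, decide_eq_true_eq]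
  exact ⟨by rintro ⟨i, hi, rfl⟩; exact hi, fun h => ⟨e.symm p, by simpa using h, by simp⟩⟩

theorem length_elems_le (S : Finset P) : (elems e S).length ≤ n := by
  simpa [elems] using List.length_filter_le _ (List.finRange n)

theorem enc_injective : Function.Injective (enc e) := by
  have key : ∀ {n : ℕ} (p q : Fin n → Prop), encodePred p = encodePred q → p = q := by
    intro n
    induction n with
    | zero => intro p q _; exact funext fun i => i.elim0
    | succ n ih =>
      intro p q h
      rw [encodePred_succ, encodePred_succ, Tree.cons.injEq] at h
      have h0 := decide_eq_decide.1 (ofBool_injective h.1)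
      have h1 := ih _ _ h.2
      exact funext fun i => Fin.cases (propext h0) (fun i => congrFun h1 i) i
  intro X Y h
  ext p
  simpa using iff_of_eq (congrFun (key _ _ h) (e.symm p))

theorem nodes_enc_le (X : Finset P) : (enc e X).nodes ≤ 4 * n + 1 := nodes_encodePred _

theorem enc_mem_map_iff {X : Finset P} {A : List (Finset P)} : enc e X ∈ A.map (enc e) ↔ X ∈ A :=
  List.mem_map_of_injective (enc_injective e)

/-- The members of `A` that contain `p`. -/
noncomputable def having (A : List (Finset P)) (p : P) : List (Finset P) := A.filter (p ∈ ·)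

/-- The members of `A` that do not contain `p`. -/
noncomputable def lacking (A : List (Finset P)) (p : P) : List (Finset P) := A.filter (p ∉ ·)

/-- The sets `X \ U` with `X` in `A`, without repetitions. -/
noncomputable def removeAll (A : List (Finset P)) (U : Finset P) : List (Finset P) :=
  (A.map (· \ U)).dedup

/-- The frequency of `p` in `A` multiplied by `|A| * |C|`, or that of `p` in `C` multiplied by
`|A| * |C|`, whichever is larger. -/
noncomputable def score (A C : List (Finset P)) (p : P) : ℕ :=
  max ((having A p).length * C.length) ((having C p).length * A.length)

/-- The frequency of `p` in `C` is less than `1 / (k * log_{4/3} N)`. -/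
def Infrequent (C : List (Finset P)) (k N : ℕ) (p : P) : Prop :=
  N ^ (k * (having C p).length) * 3 ^ C.length < 4 ^ C.length

theorem length_having_le (A : List (Finset P)) (p : P) : (having A p).length ≤ A.length :=
  List.length_filter_le _ _

theorem length_lacking_le (A : List (Finset P)) (p : P) : (lacking A p).length ≤ A.length :=
  List.length_filter_le _ _

theorem length_having_add_length_lacking (A : List (Finset P)) (p : P) :
    (having A p).length + (lacking A p).length = A.length := by
  induction A with
  | nil => rfl
  | cons X A ih =>
    simp only [having, lacking] at ih ⊢
    by_cases h : p ∈ X <;> simp only [List.filter_cons, h, decide_true, decide_false, not_true,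
      not_false_eq_true, if_true, Bool.false_eq_true, if_false, List.length_cons] <;> omega

theorem length_removeAll_le (A : List (Finset P)) (U : Finset P) :
    (removeAll A U).length ≤ A.length := by
  simpa [removeAll] using (List.dedup_sublist (A.map (· \ U))).length_le

theorem runs_nth_enc (X : Finset P) (p : P) :
    Runs .nth [enc e X, idx e p] (ofBool (decide (p ∈ X))) (20 * n) := by
  have hv : ofBool (decide (p ∈ X)) =
      ofBool (@decide (e (e.symm p) ∈ X) (Classical.propDecidable _)) := by simp
  rw [hv]
  exact (runs_nth (fun i => ofBool (@decide (e i ∈ X) (Classical.propDecidable _)))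
    (e.symm p)).mono (Nat.mul_le_mul_left _ (e.symm p).isLt)

theorem runs_diff_enc (X Y : Finset P) :
    Runs .diff [enc e X, enc e Y] (enc e (X \ Y)) (40 * (n + 1)) := by
  have h : enc e (X \ Y) = encodePred fun i => e i ∈ X ∧ ¬ e i ∈ Y := by simp [enc]
  rw [h]
  exact runs_diff _ _

theorem runs_mem_fam (X : Finset P) (A : List (Finset P)) :
    Runs .mem [enc e X, fam e A] (ofBool (decide (X ∈ A)))
      ((A.length + 1) * (160 * n + 80)) := by
  have h := runs_mem (enc e X) (A.map (enc e))
  rw [decide_eq_decide.2 (enc_mem_map_iff e)] at h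
  refine h.mono ?_
  rw [List.length_map]
  exact Nat.mul_le_mul_left _ (by linarith [nodes_enc_le e X])

theorem runs_removeAll (A : List (Finset P)) (U : Finset P) (K : ℕ) (hK : 1000 ≤ K) (hn : n ≤ K)
    (hA : A.length ≤ K) :
    Runs .removeAll [fam e A, enc e U] (fam e (removeAll A U)) ((A.length + 1) * K ^ 3) := by
  have hK3 : (K + 1) * (40 * (4 * K + 1) + 40) + 40 * (K + 1) + 100 ≤ K ^ 3 := by
    obtain ⟨j, rfl⟩ := Nat.exists_eq_add_of_le hK
    ring_nf
    omega
  induction A with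
  | nil => exact (Ev.iteNil .arg0 .nil).mono (by simp only [List.length_nil]; omega)
  | cons X A ih =>
    simp only [List.length_cons] at hA
    have hi := runs_insert (enc e (X \ U)) ((removeAll A U).map (enc e))
    have hv : ofList (if enc e (X \ U) ∈ (removeAll A U).map (enc e) then
        (removeAll A U).map (enc e) else enc e (X \ U) :: (removeAll A U).map (enc e)) =
        fam e (removeAll (X :: A) U) := by
      rw [fam]
      congr 1
      split_ifs with h
      · rw [enc_mem_map_iff] at h
        rw [removeAll, removeAll, List.map_cons, List.dedup_cons_of_mem' h]
      · rw [enc_mem_map_iff] at h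
        rw [removeAll, removeAll, List.map_cons, List.dedup_cons_of_notMem' h, List.map_cons]
    rw [hv] at hi
    refine (Ev.iteCons .arg0 (.app2 (.app2 (.head .arg0) .arg1 (runs_diff_enc e X U))
      (.app2 (.tail .arg0) .arg1 (ih (by omega))) hi)).mono ?_
    have h1 : (((removeAll A U).map (enc e)).length + 1) * (40 * (enc e (X \ U)).nodes + 40) ≤
        (K + 1) * (40 * (4 * K + 1) + 40) := by
      rw [List.length_map]
      have := length_removeAll_le A U
      have := nodes_enc_le e (X \ U)
      gcongr <;> omega
    have h2 : (A.length + 1 + 1) * K ^ 3 = (A.length + 1) * K ^ 3 + K ^ 3 := by ring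
    simp only [List.length_cons]
    omega

theorem runs_having (A : List (Finset P)) (p : P) :
    Runs .having [fam e A, idx e p] (fam e (having A p)) ((A.length + 1) * (20 * n + 50)) := by
  induction A with
  | nil => exact (Ev.iteNil .arg0 .nil).mono (by simp only [List.length_nil]; omega)
  | cons X A ih =>
    refine (Ev.iteCons .arg0 (.iteBool (t := (A.length + 1) * (20 * n + 50) + 20)
      (.app2 (.head .arg0) .arg1 (runs_nth_enc e X p)) (fun h => ?_) fun h => ?_)).mono
      (by simp only [List.length_cons]; linarith)
    · rw [having, List.filter_cons, if_pos h]
      exact (Ev.cons (.head .arg0) (.app2 (.tail .arg0) .arg1 ih)).mono (by omega)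
    · rw [having, List.filter_cons, if_neg (by simpa using h)]
      exact (Ev.app2 (.tail .arg0) .arg1 ih).mono (by omega)

theorem runs_lacking (A : List (Finset P)) (p : P) :
    Runs .lacking [fam e A, idx e p] (fam e (lacking A p)) ((A.length + 1) * (20 * n + 50)) := by
  induction A with
  | nil => exact (Ev.iteNil .arg0 .nil).mono (by simp only [List.length_nil]; omega)
  | cons X A ih =>
    refine (Ev.iteCons .arg0 (.iteBool (t := (A.length + 1) * (20 * n + 50) + 20)
      (.app2 (.head .arg0) .arg1 (runs_nth_enc e X p)) (fun h => ?_) fun h => ?_)).mono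
      (by simp only [List.length_cons]; linarith)
    · rw [lacking, List.filter_cons, if_neg (by simpa using h)]
      exact (Ev.app2 (.tail .arg0) .arg1 ih).mono (by omega)
    · rw [lacking, List.filter_cons, if_pos (by simpa using h)]
      exact (Ev.cons (.head .arg0) (.app2 (.tail .arg0) .arg1 ih)).mono (by omega)

theorem runs_complement (A : List (Finset P)) (S : Finset P) :
    Runs .complement [fam e A, enc e S] (fam e (A.map (S \ ·)))
      ((A.length + 1) * (40 * n + 80)) := by
  induction A with
  | nil => exact (Ev.iteNil .arg0 .nil).mono (by simp only [List.length_nil]; omega)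
  | cons X A ih =>
    exact (Ev.iteCons .arg0 (.cons (.app2 .arg1 (.head .arg0) (runs_diff_enc e S X))
      (.app2 (.tail .arg0) .arg1 ih))).mono (by simp only [List.length_cons]; linarith)

theorem runs_length_fam (A : List (Finset P)) :
    Runs .length [fam e A] (num A.length) (20 * (A.length + 1)) := by
  have h := runs_length (A.map (enc e))
  rwa [List.length_map] at h

theorem runs_size_enc (X : Finset P) : Runs .size [enc e X] (num X.card) (30 * (n + 1)) := by
  have h := runs_size fun i => e i ∈ X
  have hc : (Finset.univ.filter fun i => e i ∈ X).card = X.card := by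
    rw [← Finset.card_map e.toEmbedding]
    congr 1
    ext p
    simp only [Finset.mem_map, Finset.mem_filter, Finset.mem_univ, true_and]
    exact ⟨by rintro ⟨i, hi, rfl⟩; exact hi, fun h => ⟨e.symm p, by simpa using h, by simp⟩⟩
  rw [hc] at h
  exact h

theorem card_le_of_equiv {n : ℕ} (e : Fin n ≃ P) (X : Finset P) : X.card ≤ n := by
  rw [← Finset.card_map e.symm.toEmbedding]
  exact (Finset.card_le_univ _).trans_eq (Fintype.card_fin n)

theorem runs_elements_enc (S : Finset P) :
    Runs .elements [enc e S, .nil] (ofList ((elems e S).map (idx e))) (40 * (n + 1)) := by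
  have h := runs_elements (fun i => e i ∈ S) 0
  have hl : (elems e S).map (idx e) =
      ((List.finRange n).filter fun i => e i ∈ S).map fun j : Fin n => num (j + 0) := by
    simp only [elems, List.map_map]
    refine List.map_congr_left fun i _ => ?_
    simp [idx]
  rw [← hl] at h
  exact h

theorem score_le (A C : List (Finset P)) (p : P) : score A C p ≤ A.length * C.length := by
  refine max_le (Nat.mul_le_mul_right _ (length_having_le A p)) ?_
  rw [Nat.mul_comm A.length]
  exact Nat.mul_le_mul_right _ (length_having_le C p)

theorem runs_score (A C : List (Finset P)) (p : P) (K : ℕ) (hK : 1000 ≤ K) (hn : n ≤ K)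
    (hA : A.length ≤ K) (hC : C.length ≤ K) :
    Runs .score [fam e A, fam e C, idx e p] (num (score A C p)) (K ^ 3) := by
  have hA' := (length_having_le A p).trans hA
  have hC' := (length_having_le C p).trans hC
  refine (Ev.app2
    (.app2 (.app1 (.app2 .arg0 .arg2 (runs_having e A p)) (runs_length_fam e _))
      (.app1 .arg1 (runs_length_fam e C)) (runs_mul _ _))
    (.app2 (.app1 (.app2 .arg1 .arg2 (runs_having e C p)) (runs_length_fam e _))
      (.app1 .arg0 (runs_length_fam e A)) (runs_mul _ _)) (runs_max _ _)).mono ?_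
  have b1 : (A.length + 1) * (20 * n + 50) ≤ (K + 1) * (20 * K + 50) := by gcongr
  have b2 : (C.length + 1) * (20 * n + 50) ≤ (K + 1) * (20 * K + 50) := by gcongr
  have b3 : ((having A p).length + 1) * (20 * C.length + 50) ≤ (K + 1) * (20 * K + 50) := by gcongr
  have b4 : ((having C p).length + 1) * (20 * A.length + 50) ≤ (K + 1) * (20 * K + 50) := by gcongr
  have b5 : (having C p).length * A.length ≤ K * K := by gcongr
  have b6 : 4 * ((K + 1) * (20 * K + 50)) + 30 * (K * K) + 80 * K + 300 ≤ K ^ 3 := by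
    obtain ⟨j, rfl⟩ := Nat.exists_eq_add_of_le hK
    ring_nf
    omega
  omega

theorem runs_withScore (l : List P) (A C : List (Finset P)) (K : ℕ) (hK : 1000 ≤ K) (hn : n ≤ K)
    (hA : A.length ≤ K) (hC : C.length ≤ K) :
    Runs .withScore [ofList (l.map (idx e)), fam e A, fam e C]
      (ofList ((l.map fun p => (score A C p, p)).map (pair (idx e))))
      ((l.length + 1) * (K ^ 3 + 50)) := by
  induction l with
  | nil => exact (Ev.iteNil .arg0 .nil).mono (by simp only [List.length_nil]; omega)
  | cons p l ih =>
    exact (Ev.iteCons .arg0 (.cons (.cons (.app3 .arg1 .arg2 (.head .arg0)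
      (runs_score e A C p K hK hn hA hC)) (.head .arg0)) (.app3 (.tail .arg0) .arg1 .arg2 ih))).mono
      (by simp only [List.length_cons]; linarith)

theorem runs_allInfrequent (l : List P) (C : List (Finset P)) (k N K : ℕ) (hK : 1000 ≤ K)
    (hn : n ≤ K) (hC : C.length ≤ K) (hk : k ≤ K ^ 2) (hN : N ≤ K) :
    Runs .allInfrequent [ofList (l.map (idx e)), fam e C, num k, num N]
      (ofBool (decide (∀ p ∈ l, Infrequent C k N p))) ((l.length + 1) * (2 * K ^ 11)) := by
  have b1 : (C.length + 1) * (20 * n + 50) ≤ (K + 1) * (20 * K + 50) := by gcongr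
  have b2 : (K + 1) * (20 * K + 50) + 40 * K + 200 ≤ K ^ 11 := by
    calc _ ≤ K ^ 3 := by
          obtain ⟨j, rfl⟩ := Nat.exists_eq_add_of_le hK
          ring_nf
          omega
      _ ≤ K ^ 11 := Nat.pow_le_pow_right (by omega) (by omega)
  induction l with
  | nil =>
    rw [decide_eq_true (by simp)]
    exact (Ev.iteNil .arg0 .tt).mono (by simp only [List.length_nil]; omega)
  | cons p l ih =>
    have hc := length_having_le C p
    simp only [List.forall_mem_cons, Bool.decide_and]
    have hi := runs_infrequent (having C p).length C.length k N K (by omega) (hc.trans hC) hC hk hN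
    have hi' : Runs .infrequent [num (having C p).length, num C.length, num k, num N]
        (ofBool (decide (Infrequent C k N p))) (K ^ 11) := by
      unfold Infrequent
      convert hi
    refine (Ev.iteCons .arg0 (.and (.app4 (.app1 (.app2 .arg1 (.head .arg0) (runs_having e C p))
      (runs_length_fam e _)) (.app1 .arg1 (runs_length_fam e C)) .arg2 .arg3 hi')
      fun _ => .app4 (.tail .arg0) .arg1 .arg2 .arg3 ih)).mono ?_
    have h2 : (l.length + 1 + 1) * (2 * K ^ 11) = (l.length + 1) * (2 * K ^ 11) + 2 * K ^ 11 := by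
      ring
    simp only [List.length_cons]
    omega

variable [PartialOrder P]

/-- The part of `S` below `p`. -/
noncomputable def below (S : Finset P) (p : P) : Finset P := S.filter (· ≤ p)

/-- The part of `S` above `p`. -/
noncomputable def above (S : Finset P) (p : P) : Finset P := S.filter (p ≤ ·)

/-- The number of elements of `S` below `p` plus the number of elements of `S` above `p`. -/
noncomputable def nbhdCard (S : Finset P) (p : P) : ℕ := (below S p).card + (above S p).card

theorem runs_down (S : Finset P) (p : P) :
    Runs .down [encodePoset e, enc e S, idx e p] (enc e (below S p))
      ((n + 1) * (20 * n + 140)) := by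
  have h1 : Runs .col [encodePoset e, idx e p] (encodePred fun i => e i ≤ p)
      ((n + 1) * (20 * (e.symm p) + 60)) := by
    have h := runs_col (fun i j => ofBool (decide (e i ≤ e j))) (e.symm p)
    simp only [Equiv.apply_symm_apply] at h
    exact h
  have h2 := runs_inter (fun i => e i ∈ S) fun i => e i ≤ p
  have h3 : enc e (below S p) = encodePred fun i => e i ∈ S ∧ e i ≤ p := by simp [enc, below]
  rw [h3]
  refine (Ev.app2 .arg1 (.app2 .arg0 .arg2 h1) h2).mono ?_
  have : (e.symm p : ℕ) ≤ n := by omega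
  nlinarith

theorem runs_up (S : Finset P) (p : P) :
    Runs .up [encodePoset e, enc e S, idx e p] (enc e (above S p)) (60 * n + 80) := by
  have h1 : Runs .nth [encodePoset e, idx e p] (encodePred fun i => p ≤ e i)
      (20 * (e.symm p + 1)) := by
    have h := runs_nth (fun i => encodePred fun j => e i ≤ e j) (e.symm p)
    simp only [Equiv.apply_symm_apply] at h
    exact h
  have h2 := runs_inter (fun i => e i ∈ S) fun i => p ≤ e i
  have h3 : enc e (above S p) = encodePred fun i => e i ∈ S ∧ p ≤ e i := by simp [enc, above]
  rw [h3]
  exact (Ev.app2 .arg1 (.app2 .arg0 .arg2 h1) h2).mono (by omega)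

theorem nbhdCard_le {n : ℕ} (e : Fin n ≃ P) (S : Finset P) (p : P) : nbhdCard S p ≤ 2 * n := by
  have h1 := card_le_of_equiv e (below S p)
  have h2 := card_le_of_equiv e (above S p)
  rw [nbhdCard]
  omega

theorem runs_nbhd (S : Finset P) (p : P) :
    Runs .nbhd [encodePoset e, enc e S, idx e p] (num (nbhdCard S p))
      ((n + 1) * (20 * n + 400)) := by
  have h1 := card_le_of_equiv e (below S p)
  refine (Ev.app2 (.app1 (.app3 .arg0 .arg1 .arg2 (runs_down e S p)) (runs_size_enc e _))
    (.app1 (.app3 .arg0 .arg1 .arg2 (runs_up e S p)) (runs_size_enc e _)) (runs_add _ _)).mono ?_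
  nlinarith

theorem runs_withNbhd (l : List P) (S : Finset P) :
    Runs .withNbhd [ofList (l.map (idx e)), encodePoset e, enc e S]
      (ofList ((l.map fun p => (nbhdCard S p, p)).map (pair (idx e))))
      ((l.length + 1) * ((n + 1) * (20 * n + 400) + 50)) := by
  induction l with
  | nil => exact (Ev.iteNil .arg0 .nil).mono (by simp only [List.length_nil]; omega)
  | cons p l ih =>
    exact (Ev.iteCons .arg0 (.cons (.cons (.app3 .arg1 .arg2 (.head .arg0) (runs_nbhd e S p))
      (.head .arg0)) (.app3 (.tail .arg0) .arg1 .arg2 ih))).mono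
      (by simp only [List.length_cons]; linarith)

end Sets

section Duality

open scoped Classical

/-! ### Random subsets -/

section Random

variable {P : Type*} (S : Finset P) (r : ℝ)

/-- The probability of `Y` when each element of `S` is left out with probability `r`,
independently. -/
noncomputable def weight (Y : Finset P) : ℝ := (∏ _p ∈ Y, (1 - r)) * ∏ _p ∈ S \ Y, r

variable {S r}

theorem weight_nonneg (h0 : 0 ≤ r) (h1 : r ≤ 1) (Y : Finset P) : 0 ≤ weight S r Y :=
  mul_nonneg (Finset.prod_nonneg fun _ _ => sub_nonneg.2 h1) (Finset.prod_nonneg fun _ _ => h0)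

theorem sum_weight_disjoint {U : Finset P} (hU : U ⊆ S) :
    ∑ Y ∈ S.powerset, weight S r Y * (if Disjoint Y U then 1 else 0) = r ^ U.card := by
  have h := Finset.prod_add (fun p => if p ∈ U then 0 else 1 - r) (fun _ => r) S
  have hl : ∏ p ∈ S, ((if p ∈ U then 0 else 1 - r) + r) = r ^ U.card := by
    have : ∀ p ∈ S, ((if p ∈ U then 0 else 1 - r) + r) = if p ∈ U then r else 1 := by
      intro p _
      split_ifs <;> ring
    rw [Finset.prod_congr rfl this, Finset.prod_ite_mem, Finset.inter_eq_right.2 hU,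
      Finset.prod_const]
  rw [← hl, h]
  refine Finset.sum_congr rfl fun Y _ => ?_
  rw [weight]
  split_ifs with hd
  · rw [mul_one]
    congr 1
    exact Finset.prod_congr rfl fun p hp => by rw [if_neg (Finset.disjoint_left.1 hd hp)]
  · obtain ⟨p, hp, hpU⟩ := Finset.not_disjoint_iff.1 hd
    rw [mul_zero, Finset.prod_eq_zero hp (by rw [if_pos hpU]), zero_mul]

theorem sum_weight : ∑ Y ∈ S.powerset, weight S r Y = 1 := by
  simpa using sum_weight_disjoint (r := r) (Finset.empty_subset S)

/-- A random set meets each one of several disjoint sets with the product of the probabilities.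
The indicator of this event expands, by inclusion and exclusion, into indicators of the events to
avoid a union of some of these sets. -/
theorem sum_weight_not_disjoint {ι : Type*} (T : Finset ι) (V : ι → Finset P)
    (hV : ∀ t ∈ T, V t ⊆ S) (hd : (T : Set ι).PairwiseDisjoint V) :
    ∑ Y ∈ S.powerset, weight S r Y * (if ∀ t ∈ T, ¬ Disjoint Y (V t) then 1 else 0) =
      ∏ t ∈ T, (1 - r ^ (V t).card) := by
  have hind : ∀ Y : Finset P, (if ∀ t ∈ T, ¬ Disjoint Y (V t) then (1 : ℝ) else 0) =
      ∑ J ∈ T.powerset, (∏ _t ∈ J, (-1)) * (if Disjoint Y (J.biUnion V) then 1 else 0) := by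
    intro Y
    have h1 : (if ∀ t ∈ T, ¬ Disjoint Y (V t) then (1 : ℝ) else 0) =
        ∏ t ∈ T, (1 + -(if Disjoint Y (V t) then 1 else 0)) := by
      split_ifs with h
      · exact (Finset.prod_eq_one fun t ht => by rw [if_neg (h t ht)]; ring).symm
      · push Not at h
        obtain ⟨t, ht, hdt⟩ := h
        exact (Finset.prod_eq_zero ht (by rw [if_pos hdt]; ring)).symm
    rw [h1, Finset.prod_one_add]
    refine Finset.sum_congr rfl fun J _ => ?_
    simp only [Finset.disjoint_biUnion_right]
    split_ifs with h
    · rw [mul_one]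
      exact Finset.prod_congr rfl fun t ht => by rw [if_pos (h t ht)]
    · push Not at h
      obtain ⟨t, ht, hdt⟩ := h
      rw [mul_zero]
      exact Finset.prod_eq_zero ht (by rw [if_neg hdt]; ring)
  simp only [hind, Finset.mul_sum]
  rw [Finset.sum_comm]
  have h2 : ∏ t ∈ T, (1 - r ^ (V t).card) = ∏ t ∈ T, (1 + -r ^ (V t).card) := by
    simp only [sub_eq_add_neg]
  rw [h2, Finset.prod_one_add]
  refine Finset.sum_congr rfl fun J hJ => ?_
  have hJ' := Finset.mem_powerset.1 hJ
  calc _ = (∏ _t ∈ J, (-1 : ℝ)) *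
        ∑ Y ∈ S.powerset, weight S r Y * (if Disjoint Y (J.biUnion V) then 1 else 0) := by
        rw [Finset.mul_sum]
        exact Finset.sum_congr rfl fun Y _ => by ring
    _ = (∏ _t ∈ J, (-1 : ℝ)) * ∏ t ∈ J, r ^ (V t).card := by
        rw [sum_weight_disjoint (Finset.biUnion_subset.2 fun t ht => hV t (hJ' ht)),
          Finset.card_biUnion (fun s hs t ht hst => hd (hJ' hs) (hJ' ht) hst),
          Finset.prod_pow_eq_pow_sum]
    _ = ∏ t ∈ J, -r ^ (V t).card := by
        rw [← Finset.prod_mul_distrib]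
        exact Finset.prod_congr rfl fun t _ => by ring

end Random

/-! ### Frequencies -/

section Frequency

variable {P : Type*}

theorem mem_having {A : List (Finset P)} {X : Finset P} {p : P} :
    X ∈ having A p ↔ X ∈ A ∧ p ∈ X := by simp [having]

theorem mem_lacking {A : List (Finset P)} {X : Finset P} {p : P} :
    X ∈ lacking A p ↔ X ∈ A ∧ p ∉ X := by simp [lacking]

theorem mem_removeAll {A : List (Finset P)} {X Y : Finset P} :
    Y ∈ removeAll A X ↔ ∃ Z ∈ A, Z \ X = Y := by simp [removeAll]

theorem length_le_sum_having (C : List (Finset P)) (U : Finset P)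
    (h : ∀ X ∈ C, ∃ p ∈ U, p ∈ X) : C.length ≤ ∑ p ∈ U, (having C p).length := by
  induction C with
  | nil => simp
  | cons X C ih =>
    obtain ⟨p, hp, hpX⟩ := h X (by simp)
    have h1 : ∀ q, (having (X :: C) q).length = (having C q).length + if q ∈ X then 1 else 0 := by
      intro q
      rw [having, having, List.filter_cons]
      by_cases hq : q ∈ X <;> simp [hq]
    have h2 : 1 ≤ ∑ q ∈ U, if q ∈ X then 1 else 0 := by
      have := Finset.single_le_sum (f := fun q => if q ∈ X then 1 else 0) (fun q _ => Nat.zero_le _)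
        hp
      simpa [hpX] using this
    simp only [h1, Finset.sum_add_distrib, List.length_cons]
    have := ih fun Y hY => h Y (List.mem_cons_of_mem _ hY)
    omega

/-- A set `U` that meets all members of `C` but has only infrequent elements is large: the
frequencies of its elements add up to at least one, so `k * log_{4/3} N < |U|`. -/
theorem pow_lt_two_pow_of_infrequent {C : List (Finset P)} (hC : C ≠ []) {U : Finset P}
    (h : ∀ X ∈ C, ∃ p ∈ U, p ∈ X) {k N : ℕ} (hN : 1 ≤ N) (hU : ∀ p ∈ U, Infrequent C k N p) :
    N ^ k < 2 ^ U.card := by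
  have hsum := length_le_sum_having C U h
  have hlen : 0 < C.length := List.length_pos_iff.2 hC
  have hne : U.Nonempty := by
    rw [Finset.nonempty_iff_ne_empty]
    rintro rfl
    simp at hsum
    exact hC hsum
  have hprod : ∏ p ∈ U, N ^ (k * (having C p).length) * 3 ^ C.length < ∏ _p ∈ U, 4 ^ C.length :=
    Finset.prod_lt_prod_of_nonempty (fun p _ => by positivity) (fun p hp => hU p hp) hne
  rw [Finset.prod_mul_distrib, Finset.prod_pow_eq_pow_sum, ← Finset.mul_sum, Finset.prod_const,
    Finset.prod_const] at hprod
  have h1 : (N ^ k * 3 ^ U.card) ^ C.length < (4 ^ U.card) ^ C.length := by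
    calc (N ^ k * 3 ^ U.card) ^ C.length = N ^ (k * C.length) * (3 ^ C.length) ^ U.card := by
          rw [mul_pow, ← pow_mul, ← pow_mul, ← pow_mul, Nat.mul_comm U.card]
      _ ≤ N ^ (k * ∑ p ∈ U, (having C p).length) * (3 ^ C.length) ^ U.card := by
          gcongr
      _ < (4 ^ C.length) ^ U.card := hprod
      _ = (4 ^ U.card) ^ C.length := by rw [← pow_mul, ← pow_mul, Nat.mul_comm]
  have h2 := lt_of_pow_lt_pow_left₀ _ (by positivity) h1
  have h3 : N ^ k * 3 ^ U.card < 2 ^ U.card * 3 ^ U.card := by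
    rw [← mul_pow]
    exact h2.trans_le (Nat.pow_le_pow_left (by norm_num) _)
  exact lt_of_mul_lt_mul_right h3 (by positivity)

end Frequency

/-! ### Duality in a subposet -/

variable {P : Type*} [PartialOrder P]

/-- `X` is a downset of the subposet `S`. -/
def IsDownset (S X : Finset P) : Prop := X ⊆ S ∧ ∀ x ∈ X, ∀ y ∈ S, y ≤ x → y ∈ X

/-- The families `A` and `B` are dual in the lattice of downsets of the subposet `S`. -/
def DualIn (S : Finset P) (A B : List (Finset P)) : Prop :=
  (∀ a ∈ A, ∀ b ∈ B, ¬ a ⊆ b) ∧ ∀ X, IsDownset S X → (∃ b ∈ B, X ⊆ b) ∨ ∃ a ∈ A, a ⊆ X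

variable {S X Y : Finset P} {A B : List (Finset P)} {p q : P}

theorem mem_below : q ∈ below S p ↔ q ∈ S ∧ q ≤ p := by simp [below]

theorem mem_above : q ∈ above S p ↔ q ∈ S ∧ p ≤ q := by simp [above]

theorem IsDownset.sdiff_below (h : IsDownset S X) :
    IsDownset (S \ below S p) (X \ below S p) := by
  refine ⟨Finset.sdiff_subset_sdiff h.1 le_rfl, fun x hx y hy hyx => ?_⟩
  rw [Finset.mem_sdiff] at *
  exact ⟨h.2 x hx.1 y hy.1 hyx, hy.2⟩

theorem IsDownset.sdiff_above (h : IsDownset S X) :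
    IsDownset (S \ above S p) (X \ above S p) := by
  refine ⟨Finset.sdiff_subset_sdiff h.1 le_rfl, fun x hx y hy hyx => ?_⟩
  rw [Finset.mem_sdiff] at *
  exact ⟨h.2 x hx.1 y hy.1 hyx, hy.2⟩

/-- A downset without `p` does not meet the elements above `p`. -/
theorem IsDownset.disjoint_above (h : IsDownset S X) (hp : p ∈ S) (hpX : p ∉ X) :
    Disjoint X (above S p) :=
  Finset.disjoint_left.2 fun x hx hx' => hpX (h.2 x hx p hp (mem_above.1 hx').2)

theorem IsDownset.of_lacking (h : IsDownset S X) (hp : p ∈ S) (hpX : p ∉ X) :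
    IsDownset (S \ above S p) X := by
  have := h.sdiff_above (p := p)
  rwa [Finset.sdiff_eq_self_of_disjoint (h.disjoint_above hp hpX)] at this

theorem IsDownset.below_subset (h : IsDownset S X) (hpX : p ∈ X) : below S p ⊆ X :=
  fun q hq => h.2 p hpX q (mem_below.1 hq).1 (mem_below.1 hq).2

theorem IsDownset.union_below (h : IsDownset (S \ below S p) X) :
    IsDownset S (X ∪ below S p) := by
  refine ⟨Finset.union_subset (h.1.trans Finset.sdiff_subset) (Finset.filter_subset _ _), ?_⟩
  intro x hx y hy hyx
  by_cases hyp : y ≤ p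
  · exact Finset.mem_union_right _ (mem_below.2 ⟨hy, hyp⟩)
  · rcases Finset.mem_union.1 hx with hx | hx
    · exact Finset.mem_union_left _ (h.2 x hx y
        (Finset.mem_sdiff.2 ⟨hy, fun h' => hyp (mem_below.1 h').2⟩) hyx)
    · exact absurd (hyx.trans (mem_below.1 hx).2) hyp

theorem IsDownset.of_sdiff_above (hp : p ∈ S) (h : IsDownset (S \ above S p) X) :
    IsDownset S X ∧ p ∉ X := by
  have hpX : p ∉ X := fun hpX => (Finset.mem_sdiff.1 (h.1 hpX)).2 (mem_above.2 ⟨hp, le_rfl⟩)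
  refine ⟨⟨h.1.trans Finset.sdiff_subset, fun x hx y hy hyx => h.2 x hx y ?_ hyx⟩, hpX⟩
  refine Finset.mem_sdiff.2 ⟨hy, fun hy' => (Finset.mem_sdiff.1 (h.1 hx)).2 ?_⟩
  exact mem_above.2 ⟨(Finset.mem_sdiff.1 (h.1 hx)).1, (mem_above.1 hy').2.trans hyx⟩

/-- The downsets that contain `p` and those that do not contain `p` can be tested separately. -/
theorem dualIn_iff_decompose (hB : ∀ X ∈ B, IsDownset S X)
    (hp : p ∈ S) :
    DualIn S A B ↔
      DualIn (S \ below S p) (removeAll A (below S p)) (removeAll (having B p) (below S p)) ∧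
      DualIn (S \ above S p) (lacking A p) (removeAll B (above S p)) := by
  constructor
  · rintro ⟨h1, h2⟩
    refine ⟨⟨?_, ?_⟩, ⟨?_, ?_⟩⟩
    · intro a' ha' b' hb' hab
      obtain ⟨a, ha, rfl⟩ := mem_removeAll.1 ha'
      obtain ⟨b, hb, rfl⟩ := mem_removeAll.1 hb'
      obtain ⟨hb, hpb⟩ := mem_having.1 hb
      refine h1 a ha b hb fun x hx => ?_
      by_cases hx' : x ∈ below S p
      · exact (hB b hb).below_subset hpb hx'
      · exact (Finset.mem_sdiff.1 (hab (Finset.mem_sdiff.2 ⟨hx, hx'⟩))).1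
    · intro X hX
      rcases h2 _ (hX.union_below) with ⟨b, hb, hXb⟩ | ⟨a, ha, haX⟩
      · have hpb : p ∈ b := hXb (Finset.mem_union_right _ (mem_below.2 ⟨hp, le_rfl⟩))
        refine .inl ⟨_, mem_removeAll.2 ⟨b, mem_having.2 ⟨hb, hpb⟩, rfl⟩, fun x hx => ?_⟩
        exact Finset.mem_sdiff.2 ⟨hXb (Finset.mem_union_left _ hx),
          (Finset.mem_sdiff.1 (hX.1 hx)).2⟩
      · refine .inr ⟨_, mem_removeAll.2 ⟨a, ha, rfl⟩, fun x hx => ?_⟩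
        obtain ⟨hx, hx'⟩ := Finset.mem_sdiff.1 hx
        exact (Finset.mem_union.1 (haX hx)).resolve_right hx'
    · intro a ha' b' hb' hab
      obtain ⟨ha, hpa⟩ := mem_lacking.1 ha'
      obtain ⟨b, hb, rfl⟩ := mem_removeAll.1 hb'
      exact h1 a ha b hb (hab.trans Finset.sdiff_subset)
    · intro X hX
      obtain ⟨hXS, hpX⟩ := hX.of_sdiff_above hp
      rcases h2 X hXS with ⟨b, hb, hXb⟩ | ⟨a, ha, haX⟩
      · exact .inl ⟨_, mem_removeAll.2 ⟨b, hb, rfl⟩, fun x hx =>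
          Finset.mem_sdiff.2 ⟨hXb hx, (Finset.mem_sdiff.1 (hX.1 hx)).2⟩⟩
      · exact .inr ⟨a, mem_lacking.2 ⟨ha, fun h => hpX (haX h)⟩, haX⟩
  · rintro ⟨⟨h1, h2⟩, ⟨h3, h4⟩⟩
    refine ⟨?_, ?_⟩
    · intro a ha b hb hab
      by_cases hpb : p ∈ b
      · exact h1 _ (mem_removeAll.2 ⟨a, ha, rfl⟩) _
          (mem_removeAll.2 ⟨b, mem_having.2 ⟨hb, hpb⟩, rfl⟩) (Finset.sdiff_subset_sdiff hab le_rfl)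
      · have hpa : p ∉ a := fun h => hpb (hab h)
        refine h3 a (mem_lacking.2 ⟨ha, hpa⟩) _ (mem_removeAll.2 ⟨b, hb, rfl⟩) ?_
        rwa [Finset.sdiff_eq_self_of_disjoint ((hB b hb).disjoint_above hp hpb)]
    · intro X hX
      by_cases hpX : p ∈ X
      · rcases h2 _ (hX.sdiff_below (p := p)) with ⟨b', hb', hXb⟩ | ⟨a', ha', haX⟩
        · obtain ⟨b, hb, rfl⟩ := mem_removeAll.1 hb'
          obtain ⟨hb, hpb⟩ := mem_having.1 hb
          refine .inl ⟨b, hb, fun x hx => ?_⟩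
          by_cases hx' : x ∈ below S p
          · exact (hB b hb).below_subset hpb hx'
          · exact (Finset.mem_sdiff.1 (hXb (Finset.mem_sdiff.2 ⟨hx, hx'⟩))).1
        · obtain ⟨a, ha, rfl⟩ := mem_removeAll.1 ha'
          refine .inr ⟨a, ha, fun x hx => ?_⟩
          by_cases hx' : x ∈ below S p
          · exact hX.below_subset hpX hx'
          · exact (Finset.mem_sdiff.1 (haX (Finset.mem_sdiff.2 ⟨hx, hx'⟩))).1
      · rcases h4 _ (hX.of_lacking hp hpX) with ⟨b', hb', hXb⟩ | ⟨a, ha, haX⟩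
        · obtain ⟨b, hb, rfl⟩ := mem_removeAll.1 hb'
          exact .inl ⟨b, hb, hXb.trans Finset.sdiff_subset⟩
        · exact .inr ⟨a, (mem_lacking.1 ha).1, haX⟩

theorem dualIn_nil_left : DualIn S [] B ↔ ∃ b ∈ B, S ⊆ b := by
  refine ⟨fun h => ?_, fun ⟨b, hb, hSb⟩ => ⟨by simp, fun X hX => .inl ⟨b, hb, hX.1.trans hSb⟩⟩⟩
  rcases h.2 S ⟨le_rfl, fun _ _ y hy _ => hy⟩ with h | ⟨a, ha, -⟩
  · exact h
  · simp at ha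

theorem dualIn_nil_right : DualIn S A [] ↔ ∅ ∈ A := by
  refine ⟨fun h => ?_, fun h => ⟨by simp, fun X _ => .inr ⟨∅, h, Finset.empty_subset _⟩⟩⟩
  rcases h.2 ∅ ⟨Finset.empty_subset _, by simp⟩ with ⟨b, hb, -⟩ | ⟨a, ha, haX⟩
  · simp at hb
  · rwa [Finset.subset_empty.1 haX] at ha

/-- From each set one can select a large part whose members have disjoint upsets: a maximal such
part `T` is within distance two in the comparability graph of every element of the set. -/
theorem exists_disjoint_above {m : ℕ} (hm : ∀ q ∈ S, nbhdCard S q ≤ m) (hX : X ⊆ S) :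
    ∃ T ⊆ X, (T : Set P).PairwiseDisjoint (above S) ∧ X.card ≤ T.card * (m * m) := by
  have hne : (X.powerset.filter fun T : Finset P =>
      (T : Set P).PairwiseDisjoint (above S)).Nonempty := ⟨∅, by simp⟩
  obtain ⟨T, hT, hmax⟩ := Finset.exists_max_image _ Finset.card hne
  simp only [Finset.mem_filter, Finset.mem_powerset] at hT hmax
  refine ⟨T, hT.1, hT.2, ?_⟩
  have hcover : X ⊆ T.biUnion fun t => (above S t).biUnion (below S) := by
    intro x hx
    by_contra hcon
    simp only [Finset.mem_biUnion, mem_above, mem_below, not_exists, not_and] at hcon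
    have hxS := hX hx
    have hxT : x ∉ T := fun h => hcon x h x ⟨hxS, le_rfl⟩ hxS le_rfl
    have hins : ((insert x T : Finset P) : Set P).PairwiseDisjoint (above S) := by
      rw [Finset.coe_insert]
      refine hT.2.insert fun t ht _ => Finset.disjoint_left.2 fun c hc hc' => ?_
      exact hcon t ht c (mem_above.1 hc') hxS (mem_above.1 hc).2
    have := hmax _ ⟨Finset.insert_subset hx hT.1, hins⟩
    rw [Finset.card_insert_of_notMem hxT] at this
    omega
  refine (Finset.card_le_card hcover).trans (Finset.card_biUnion_le_card_mul _ _ _ fun t ht => ?_)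
  have h1 := hm t (hX (hT.1 ht))
  rw [nbhdCard] at h1
  refine (Finset.card_biUnion_le_card_mul _ _ m fun c hc => ?_).trans
    (Nat.mul_le_mul_right _ (by omega))
  have h2 := hm c (mem_above.1 hc).1
  rw [nbhdCard] at h2
  omega

theorem sum_map_lt {α : Type*} (l : List α) (f : α → ℝ) (c : ℝ) (h : ∀ x ∈ l, f x < c)
    (hl : l ≠ []) : (l.map f).sum < l.length * c := by
  have := List.sum_lt_sum_of_ne_nil hl f (fun _ => c) h
  simpa using this

/-- If no element is frequent then the families are not dual.  Every element of the subposet is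
selected independently such that a set of `m` elements is avoided with probability `1/2`.  With
positive probability, the downset generated by the selected elements is neither contained in a
member of `B` nor contains a member of `A`. -/
theorem not_dualIn_of_infrequent (hA : ∀ X ∈ A, IsDownset S X) (hA' : A ≠ []) (hB' : B ≠ [])
    {m : ℕ} (hm : ∀ q ∈ S, nbhdCard S q ≤ m)
    (hfA : ∀ q ∈ S, Infrequent A m (A.length + B.length) q)
    (hfB : ∀ q ∈ S, Infrequent (B.map (S \ ·)) (m * m) (A.length + B.length) q) :
    ¬ DualIn S A B := by
  rintro ⟨hd, hcov⟩
  set N := A.length + B.length with hN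
  have hApos : 0 < A.length := List.length_pos_iff.2 hA'
  have hN1 : 1 ≤ N := by omega
  have hmeet : ∀ a ∈ A, ∀ b ∈ B, ∃ p ∈ a, p ∈ S \ b := by
    intro a ha b hb
    obtain ⟨p, hp, hpb⟩ := Finset.not_subset.1 (hd a ha b hb)
    exact ⟨p, hp, Finset.mem_sdiff.2 ⟨(hA a ha).1 hp, hpb⟩⟩
  have hlargeB : ∀ b ∈ B, N ^ m < 2 ^ (S \ b).card := fun b hb =>
    pow_lt_two_pow_of_infrequent hA' (fun a ha => (hmeet a ha b hb).imp fun p h => ⟨h.2, h.1⟩) hN1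
      fun p hp => hfA p (Finset.mem_sdiff.1 hp).1
  have hlargeA : ∀ a ∈ A, N ^ (m * m) < 2 ^ a.card := fun a ha =>
    pow_lt_two_pow_of_infrequent (by simpa using hB')
      (fun X hX => by
        obtain ⟨b, hb, rfl⟩ := List.mem_map.1 hX
        exact hmeet a ha b hb) hN1
      fun p hp => hfB p ((hA a ha).1 hp)
  have hm0 : m ≠ 0 := by
    obtain ⟨a, ha⟩ := List.exists_mem_of_ne_nil _ hA'
    obtain ⟨b, hb⟩ := List.exists_mem_of_ne_nil _ hB'
    obtain ⟨p, hp, -⟩ := hmeet a ha b hb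
    have hpS := (hA a ha).1 hp
    have h1 := hm p hpS
    have h2 : 0 < (below S p).card := Finset.card_pos.2 ⟨p, mem_below.2 ⟨hpS, le_rfl⟩⟩
    rw [nbhdCard] at h1
    omega
  -- A set of `m` elements is avoided with probability `1 / 2`.
  obtain ⟨r, hr0, hrm⟩ : ∃ r : ℝ, 0 ≤ r ∧ r ^ m = 1 / 2 :=
    ⟨(1 / 2 : ℝ) ^ (1 / (m : ℝ)), by positivity, by
      rw [one_div (m : ℝ)]
      exact Real.rpow_inv_natCast_pow (by norm_num) hm0⟩
  have hr1 : r ≤ 1 := by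
    by_contra h
    have := one_le_pow₀ (n := m) (not_le.1 h).le
    rw [hrm] at this
    norm_num at this
  have hNpos : (0 : ℝ) < N := by exact_mod_cast hN1
  -- The probability that the random set is contained in a given member of `B`.
  have hpB : ∀ b ∈ B, r ^ (S \ b).card < 1 / N := by
    intro b hb
    refine lt_of_pow_lt_pow_left₀ m (by positivity) ?_
    rw [← pow_mul, Nat.mul_comm, pow_mul, hrm, one_div_pow, one_div_pow]
    have : (N : ℝ) ^ m < 2 ^ (S \ b).card := by exact_mod_cast hlargeB b hb
    exact one_div_lt_one_div_of_lt (by positivity) this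
  -- The probability that the generated downset contains a given member of `A`.
  have hpA : ∀ a ∈ A, ∑ Y ∈ S.powerset,
      weight S r Y * (if ∀ x ∈ a, ¬ Disjoint Y (above S x) then 1 else 0) < 1 / N := by
    intro a ha
    obtain ⟨T, hTa, hTd, hcard⟩ := exists_disjoint_above hm (hA a ha).1
    have hle : ∀ t ∈ T, (above S t).card ≤ m := by
      intro t ht
      have := hm t ((hA a ha).1 (hTa ht))
      rw [nbhdCard] at this
      omega
    have hNT : N < 2 ^ T.card := by
      refine lt_of_pow_lt_pow_left₀ (m * m) (by positivity) ?_
      rw [← pow_mul]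
      exact (hlargeA a ha).trans_le (Nat.pow_le_pow_right (by norm_num) hcard)
    calc _ ≤ ∑ Y ∈ S.powerset,
          weight S r Y * (if ∀ t ∈ T, ¬ Disjoint Y (above S t) then 1 else 0) := by
          refine Finset.sum_le_sum fun Y _ =>
            mul_le_mul_of_nonneg_left ?_ (weight_nonneg hr0 hr1 Y)
          split_ifs with h1 h2
          · exact le_rfl
          · exact absurd (fun t ht => h1 t (hTa ht)) h2
          · exact zero_le_one
          · exact le_rfl
      _ = ∏ t ∈ T, (1 - r ^ (above S t).card) :=
          sum_weight_not_disjoint T _ (fun t _ => Finset.filter_subset _ _) hTd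
      _ ≤ ∏ _t ∈ T, (1 / 2 : ℝ) := by
          refine Finset.prod_le_prod (fun t _ => sub_nonneg.2 (pow_le_one₀ hr0 hr1)) fun t ht => ?_
          have := pow_le_pow_of_le_one hr0 hr1 (hle t ht)
          rw [hrm] at this
          linarith
      _ = 1 / 2 ^ T.card := by rw [Finset.prod_const, one_div_pow]
      _ < 1 / N := one_div_lt_one_div_of_lt hNpos (by exact_mod_cast hNT)
  -- By duality, at least one of these events occurs for every selection `Y`.
  have hone : ∀ Y ∈ S.powerset, (1 : ℝ) ≤
      (B.map fun b => if Disjoint Y (S \ b) then (1 : ℝ) else 0).sum +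
      (A.map fun a => if ∀ x ∈ a, ¬ Disjoint Y (above S x) then (1 : ℝ) else 0).sum := by
    intro Y hY
    have hYS := Finset.mem_powerset.1 hY
    have hB0 : ∀ x ∈ B.map fun b => if Disjoint Y (S \ b) then (1 : ℝ) else 0, 0 ≤ x := by
      intro x hx
      obtain ⟨b, -, rfl⟩ := List.mem_map.1 hx
      split_ifs <;> norm_num
    have hA0 : ∀ x ∈ A.map fun a => if ∀ x ∈ a, ¬ Disjoint Y (above S x) then (1 : ℝ) else 0,
        0 ≤ x := by
      intro x hx
      obtain ⟨b, -, rfl⟩ := List.mem_map.1 hx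
      split_ifs <;> norm_num
    have hdown : IsDownset S (S.filter fun x => ∃ y ∈ Y, x ≤ y) := by
      refine ⟨Finset.filter_subset _ _, fun x hx y hy hyx => ?_⟩
      obtain ⟨-, z, hz, hxz⟩ := Finset.mem_filter.1 hx
      exact Finset.mem_filter.2 ⟨hy, z, hz, hyx.trans hxz⟩
    rcases hcov _ hdown with ⟨b, hb, hYb⟩ | ⟨a, ha, haY⟩
    · have hdis : Disjoint Y (S \ b) := Finset.disjoint_left.2 fun y hy hy' =>
        (Finset.mem_sdiff.1 hy').2 (hYb (Finset.mem_filter.2 ⟨hYS hy, y, hy, le_rfl⟩))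
      have h1 := List.single_le_sum hB0 _ (List.mem_map_of_mem hb)
      rw [if_pos hdis] at h1
      linarith [List.sum_nonneg hA0]
    · have hmeets : ∀ x ∈ a, ¬ Disjoint Y (above S x) := by
        intro x hx
        obtain ⟨hxS, y, hy, hxy⟩ := Finset.mem_filter.1 (haY hx)
        exact Finset.not_disjoint_iff.2 ⟨y, hy, mem_above.2 ⟨hYS hy, hxy⟩⟩
      have h1 := List.single_le_sum hA0 _ (List.mem_map_of_mem ha)
      rw [if_pos hmeets] at h1
      linarith [List.sum_nonneg hB0]
  have hswap : ∀ (l : List (Finset P)) (f : Finset P → Finset P → ℝ),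
      ∑ Y ∈ S.powerset, weight S r Y * (l.map (f Y)).sum =
        (l.map fun c => ∑ Y ∈ S.powerset, weight S r Y * f Y c).sum := by
    intro l f
    induction l with
    | nil => simp
    | cons c l ih => simp only [List.map_cons, List.sum_cons, mul_add, Finset.sum_add_distrib, ih]
  have htotal : (1 : ℝ) ≤ (B.map fun b => r ^ (S \ b).card).sum +
      (A.map fun a => ∑ Y ∈ S.powerset,
        weight S r Y * (if ∀ x ∈ a, ¬ Disjoint Y (above S x) then 1 else 0)).sum := by
    calc (1 : ℝ) = ∑ Y ∈ S.powerset, weight S r Y * 1 := by simp only [mul_one, sum_weight]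
      _ ≤ ∑ Y ∈ S.powerset, weight S r Y *
          ((B.map fun b => if Disjoint Y (S \ b) then (1 : ℝ) else 0).sum +
          (A.map fun a => if ∀ x ∈ a, ¬ Disjoint Y (above S x) then (1 : ℝ) else 0).sum) :=
          Finset.sum_le_sum fun Y hY =>
            mul_le_mul_of_nonneg_left (hone Y hY) (weight_nonneg hr0 hr1 Y)
      _ = _ := by
          simp only [mul_add, Finset.sum_add_distrib, hswap]
          simp only [sum_weight_disjoint Finset.sdiff_subset]
  have h1 := sum_map_lt _ _ _ hpB hB'
  have h2 := sum_map_lt _ _ _ hpA hA'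
  have h3 : (B.length : ℝ) * (1 / N) + A.length * (1 / N) = 1 := by
    rw [← add_mul, hN]
    push_cast
    rw [mul_one_div, add_comm, div_self]
    exact_mod_cast hNpos.ne'
  linarith

end Duality

/-! ### One call of the duality test -/

section Step

open scoped Classical

variable {P : Type*} {n : ℕ} (e : Fin n ≃ P)

/-- The function `best` selects an element of `S` that maximizes `f`. -/
theorem runs_best_elems {S : Finset P} (hS : S.Nonempty) (f : P → ℕ) (b : ℕ)
    (hb : ∀ p, f p ≤ b) :
    ∃ p ∈ S, (∀ q ∈ S, f q ≤ f p) ∧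
      Runs .best [ofList (((elems e S).map fun p => (f p, p)).map (pair (idx e)))]
        (.cons (num (f p)) (idx e p)) ((n + 1) * (30 * b + 100)) := by
  obtain ⟨p₀, hp₀⟩ := hS
  obtain ⟨r, hr, hmax, hrun⟩ := runs_best (idx e) b ((elems e S).map fun p => (f p, p))
    (List.ne_nil_of_mem (List.mem_map_of_mem ((mem_elems e).2 hp₀)))
    (fun r hr => by
      obtain ⟨p, -, rfl⟩ := List.mem_map.1 hr
      exact hb p)
  obtain ⟨p, hp, rfl⟩ := List.mem_map.1 hr
  refine ⟨p, (mem_elems e).1 hp,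
    fun q hq => hmax _ (List.mem_map_of_mem ((mem_elems e).2 hq)), hrun.mono ?_⟩
  rw [List.length_map]
  have := length_elems_le e S
  gcongr

variable [PartialOrder P]

/-- The arguments of the duality test for `A` and `B` on the subposet `S`. -/
noncomputable def testArgs (A B : List (Finset P)) (S : Finset P) : List Tree :=
  [fam e A, fam e B, enc e S, encodePoset e]

/-- The cost of a decomposition, given the results and costs `t₁`, `t₂` of the recursive calls. -/
theorem runs_decompose (A B : List (Finset P)) (S : Finset P) (p : P) (K : ℕ) (hK : 1000 ≤ K)
    (hn : n ≤ K) (hA : A.length ≤ K) (hB : B.length ≤ K) {b₁ b₂ : Bool} {t₁ t₂ : ℕ}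
    (h₁ : Runs .testDuality (testArgs e (removeAll A (below S p))
      (removeAll (having B p) (below S p)) (S \ below S p)) (ofBool b₁) t₁)
    (h₂ : Runs .testDuality (testArgs e (lacking A p)
      (removeAll B (above S p)) (S \ above S p)) (ofBool b₂) t₂) :
    Runs .decompose [idx e p, fam e A, fam e B, enc e S, encodePoset e] (ofBool (b₁ && b₂))
      (K ^ 5 + t₁ + t₂) := by
  have hB' := (length_having_le B p).trans hB
  have hD : Ev (ofList [idx e p, fam e A, fam e B, enc e S, encodePoset e])
      (app .down [arg 4, arg 3, arg 0]) _ _ := .app3 .arg4 .arg3 .arg0 (runs_down e S p)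
  have hU : Ev (ofList [idx e p, fam e A, fam e B, enc e S, encodePoset e])
      (app .up [arg 4, arg 3, arg 0]) _ _ := .app3 .arg4 .arg3 .arg0 (runs_up e S p)
  refine (Ev.and
    (.app4 (.app2 .arg1 hD (runs_removeAll e A (below S p) K hK hn hA))
      (.app2 (.app2 .arg2 .arg0 (runs_having e B p)) hD
        (runs_removeAll e _ (below S p) K hK hn hB'))
      (.app2 .arg3 hD (runs_diff_enc e S (below S p))) .arg4 h₁)
    fun _ => .app4 (.app2 .arg1 .arg0 (runs_lacking e A p))
      (.app2 .arg2 hU (runs_removeAll e B (above S p) K hK hn hB))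
      (.app2 .arg3 hU (runs_diff_enc e S (above S p))) .arg4 h₂).mono ?_
  have b1 : (A.length + 1) * K ^ 3 ≤ (K + 1) * K ^ 3 := by gcongr
  have b2 : (B.length + 1) * K ^ 3 ≤ (K + 1) * K ^ 3 := by gcongr
  have b3 : ((having B p).length + 1) * K ^ 3 ≤ (K + 1) * K ^ 3 := by gcongr
  have b4 : (A.length + 1) * (20 * n + 50) ≤ (K + 1) * (20 * K + 50) := by gcongr
  have b5 : (B.length + 1) * (20 * n + 50) ≤ (K + 1) * (20 * K + 50) := by gcongr
  have b6 : (n + 1) * (20 * n + 140) ≤ (K + 1) * (20 * K + 140) := by gcongr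
  have b7 : 3 * ((K + 1) * K ^ 3) + 2 * ((K + 1) * (20 * K + 50)) +
      3 * ((K + 1) * (20 * K + 140)) + 300 * K + 1000 ≤ K ^ 5 := by
    obtain ⟨j, rfl⟩ := Nat.exists_eq_add_of_le hK
    ring_nf
    omega
  omega

/-- Either more than `|S| ^ (1/3)` elements of `S`, counting `p` twice, lie below or above `p`, or
`p` is a most frequent element and some element is frequent. -/
def GoodPivot (A B : List (Finset P)) (S : Finset P) (p : P) : Prop :=
  S.card < nbhdCard S p ^ 3 ∨
    ∃ m : ℕ, m ^ 3 ≤ S.card ∧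
      (∀ q ∈ S, score A (B.map (S \ ·)) q ≤ score A (B.map (S \ ·)) p) ∧
      ∃ q ∈ S, ¬ Infrequent A m (A.length + B.length) q ∨
        ¬ Infrequent (B.map (S \ ·)) (m * m) (A.length + B.length) q

/-- The possible outcomes of a call in which both families are nonempty.  Either the call returns
`false` and no element is frequent, or it makes two recursive calls for a good pivot. -/
def StepOutcome (f : Fn) (l : List Tree) (A B : List (Finset P)) (S : Finset P) (T : ℕ) : Prop :=
  (∃ m : ℕ, (∀ q ∈ S, nbhdCard S q ≤ m) ∧
      (∀ q ∈ S, Infrequent A m (A.length + B.length) q) ∧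
      (∀ q ∈ S, Infrequent (B.map (S \ ·)) (m * m) (A.length + B.length) q) ∧
      Runs f l (ofBool false) T) ∨
    ∃ p ∈ S, GoodPivot A B S p ∧ ∀ b₁ b₂ t₁ t₂,
      Runs .testDuality (testArgs e (removeAll A (below S p))
        (removeAll (having B p) (below S p)) (S \ below S p)) (ofBool b₁) t₁ →
      Runs .testDuality (testArgs e (lacking A p)
        (removeAll B (above S p)) (S \ above S p)) (ofBool b₂) t₂ →
      Runs f l (ofBool (b₁ && b₂)) (T + t₁ + t₂)

theorem stepOutcome_branchFrequent (A B : List (Finset P)) (S : Finset P) (m K : ℕ)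
    (hK : 1000 ≤ K) (hn : n ≤ K) (hAB : A.length + B.length ≤ K)
    (hm : ∀ q ∈ S, nbhdCard S q ≤ m) (hm3 : m ^ 3 ≤ S.card) :
    StepOutcome e .branchFrequent
      [num m, fam e (B.map (S \ ·)), fam e A, fam e B, enc e S, encodePoset e] A B S
      (5 * K ^ 12) := by
  have hSn := card_le_of_equiv e S
  have hmK : m ≤ K := (Nat.le_self_pow three_ne_zero m).trans (by omega)
  have hmmK : m * m ≤ K ^ 2 := by
    rw [sq]
    gcongr
  have hmK2 : m ≤ K ^ 2 := hmK.trans (Nat.le_self_pow (by omega) K)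
  have hl := length_elems_le e S
  set C := B.map (S \ ·) with hC
  have hCB : C.length = B.length := by rw [hC, List.length_map]
  have hCK : C.length ≤ K := by omega
  have hP : Ev (ofList [num m, fam e C, fam e A, fam e B, enc e S, encodePoset e])
      (app .elements [arg 4, .nil]) _ _ := .app2 .arg4 .nil (runs_elements_enc e S)
  have hN : Ev (ofList [num m, fam e C, fam e A, fam e B, enc e S, encodePoset e])
      (app .add [app .length [arg 2], app .length [arg 3]]) _ _ :=
    .app2 (.app1 .arg2 (runs_length_fam e A)) (.app1 .arg3 (runs_length_fam e B)) (runs_add _ _)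
  have hcond := Ev.and
    (.app4 hP .arg2 .arg0 hN
      (runs_allInfrequent e (elems e S) A m (A.length + B.length) K hK hn (by omega) hmK2 hAB))
    fun _ => .app4 hP .arg1 (.app2 .arg0 .arg0 (runs_mul m m)) hN
      (runs_allInfrequent e (elems e S) C (m * m) (A.length + B.length) K hK hn hCK hmmK hAB)
  have b1 : ((elems e S).length + 1) * (2 * K ^ 11) ≤ (K + 1) * (2 * K ^ 11) := by
    gcongr
    omega
  have b2 : (m + 1) * (20 * m + 50) ≤ (K + 1) * (20 * K + 50) := by gcongr
  have b3 : ((elems e S).length + 1) * (K ^ 3 + 50) ≤ (K + 1) * (K ^ 3 + 50) := by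
    gcongr
    omega
  have b4 : (n + 1) * (30 * (K * K) + 100) ≤ (K + 1) * (30 * (K * K) + 100) := by gcongr
  have b5 : 2 * ((K + 1) * (2 * K ^ 11)) + ((K + 1) * (20 * K + 50)) + (K + 1) * (K ^ 3 + 50) +
      (K + 1) * (30 * (K * K) + 100) + 500 * K + 1000 + K ^ 5 ≤ 5 * K ^ 12 := by
    obtain ⟨j, rfl⟩ := Nat.exists_eq_add_of_le hK
    ring_nf
    omega
  by_cases hall : (∀ p ∈ elems e S, Infrequent A m (A.length + B.length) p) ∧
      ∀ p ∈ elems e S, Infrequent C (m * m) (A.length + B.length) p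
  · refine .inl ⟨m, hm, fun q hq => hall.1 q ((mem_elems e).2 hq),
      fun q hq => hall.2 q ((mem_elems e).2 hq), ?_⟩
    rw [decide_eq_true hall.1, decide_eq_true hall.2] at hcond
    exact (Ev.iteCons hcond .ff).mono (by omega)
  · have hfreq : ∃ q ∈ S, ¬ Infrequent A m (A.length + B.length) q ∨
        ¬ Infrequent C (m * m) (A.length + B.length) q := by
      by_contra hcon
      push Not at hcon
      exact hall ⟨fun p hp => (hcon p ((mem_elems e).1 hp)).1,
        fun p hp => (hcon p ((mem_elems e).1 hp)).2⟩
    obtain ⟨q, hq, hfq⟩ := hfreq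
    obtain ⟨p, hp, hmax, hbest⟩ := runs_best_elems e ⟨q, hq⟩ (score A C) (K * K) fun p =>
      (score_le A C p).trans (Nat.mul_le_mul (by omega) hCK)
    refine .inr ⟨p, hp, .inr ⟨m, hm3, hmax, q, hq, hfq⟩,
      fun b₁ b₂ t₁ t₂ h₁ h₂ => ?_⟩
    rw [← Bool.decide_and, decide_eq_false hall] at hcond
    refine (Ev.iteNil hcond (.app5 (.tail (.app1 (.app3 hP .arg2 .arg1
      (runs_withScore e (elems e S) A C K hK hn (by omega) hCK)) hbest)) .arg2 .arg3 .arg4 .arg5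
      (runs_decompose e A B S p K hK hn (by omega) (by omega) h₁ h₂))).mono ?_
    omega

theorem stepOutcome_testDuality {A B : List (Finset P)} (hA' : A ≠ []) (hB' : B ≠ [])
    (S : Finset P) (K : ℕ) (hK : 1000 ≤ K) (hn : n ≤ K) (hAB : A.length + B.length ≤ K) :
    StepOutcome e .testDuality (testArgs e A B S) A B S (K ^ 13) := by
  have hSn := card_le_of_equiv e S
  have hl := length_elems_le e S
  have b1 : ((elems e S).length + 1) * ((n + 1) * (20 * n + 400) + 50) ≤
      (K + 1) * ((K + 1) * (20 * K + 400) + 50) := by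
    gcongr
    omega
  have b2 : (n + 1) * (30 * (2 * n) + 100) ≤ (K + 1) * (30 * (2 * K) + 100) := by gcongr
  have b3 : (B.length + 1) * (40 * n + 80) ≤ (K + 1) * (40 * K + 80) := by
    gcongr
    omega
  have b4 : ∀ m ≤ 2 * K, (m + 1) * (20 * (m * m) + 50) + (m + 1) * (20 * m + 50) ≤
      (2 * K + 1) * (20 * ((2 * K) * (2 * K)) + 50) + (2 * K + 1) * (20 * (2 * K) + 50) := by
    intro m hm
    gcongr
  -- The argument `r` of `branchLarge`, whose head is the largest value of `nbhdCard S`.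
  obtain ⟨m, r, hr, hhead, hm, hmK, htail⟩ : ∃ (m : ℕ) (r : Tree),
      Runs .best [ofList (((elems e S).map fun p => (nbhdCard S p, p)).map (pair (idx e)))] r
        ((n + 1) * (30 * (2 * n) + 100)) ∧ r.head = num m ∧ (∀ q ∈ S, nbhdCard S q ≤ m) ∧
        m ≤ 2 * K ∧ (m = 0 ∨ ∃ p ∈ S, nbhdCard S p = m ∧ r.tail = idx e p) := by
    rcases S.eq_empty_or_nonempty with rfl | hS
    · refine ⟨0, .nil, ?_, rfl, by simp, by omega, .inl rfl⟩
      have : elems e ∅ = [] := List.eq_nil_iff_forall_not_mem.2 fun p hp => by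
        simpa using (mem_elems e).1 hp
      rw [this]
      exact runs_best_nil.mono (by nlinarith)
    · obtain ⟨p, hp, hmax, hrun⟩ :=
        runs_best_elems e hS (nbhdCard S) (2 * n) fun p => nbhdCard_le e S p
      exact ⟨nbhdCard S p, _, hrun, rfl, hmax, (nbhdCard_le e S p).trans (by omega),
        .inr ⟨p, hp, rfl, rfl⟩⟩
  obtain ⟨a, A, rfl⟩ := List.exists_cons_of_ne_nil hA'
  obtain ⟨b, B, rfl⟩ := List.exists_cons_of_ne_nil hB'
  set A := a :: A with hA
  set B := b :: B with hB
  have hcond : Ev (ofList (testArgs e A B S)) (Expr.and (arg 0) (arg 1)) (fam e B) 6 :=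
    .iteCons .arg0 .arg1
  have harg : Ev (ofList (testArgs e A B S))
      (app .best [app .withNbhd [app .elements [arg 2, .nil], arg 3, arg 2]]) r _ :=
    .app1 (.app3 (.app2 .arg2 .nil (runs_elements_enc e S)) .arg3 .arg2
      (runs_withNbhd e (elems e S) S)) hr
  have hhead' : Ev (ofList [r, fam e A, fam e B, enc e S, encodePoset e]) (.head (arg 0))
      (num m) 3 := by
    rw [← hhead]
    exact .head .arg0
  have hlt : Ev (ofList [r, fam e A, fam e B, enc e S, encodePoset e])
      (app .lt [app .size [arg 3],
        app .mul [.head (arg 0), app .mul [.head (arg 0), .head (arg 0)]]])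
      (ofBool (decide (S.card < m * (m * m)))) _ :=
    .app2 (.app1 .arg3 (runs_size_enc e S))
      (.app2 hhead' (.app2 hhead' hhead' (runs_mul m m)) (runs_mul m (m * m))) (runs_lt _ _)
  have b4' := b4 m hmK
  have b6 : 30 * (m * (m * m)) ≤ 30 * (2 * K * (2 * K * (2 * K))) := by gcongr
  have b7 : 30 * (2 * K * (2 * K * (2 * K))) + ((K + 1) * ((K + 1) * (20 * K + 400) + 50) +
      (K + 1) * (30 * (2 * K) + 100) +
      (K + 1) * (40 * K + 80) + ((2 * K + 1) * (20 * ((2 * K) * (2 * K)) + 50) +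
      (2 * K + 1) * (20 * (2 * K) + 50)) + 500 * K + 1000 + 5 * K ^ 12 + K ^ 5) ≤ K ^ 13 := by
    obtain ⟨j, rfl⟩ := Nat.exists_eq_add_of_le hK
    ring_nf
    omega
  by_cases hlarge : S.card < m * (m * m)
  · rw [decide_eq_true hlarge] at hlt
    obtain ⟨p, hp, hpm, hptail⟩ := htail.resolve_left (by rintro rfl; omega)
    refine .inr ⟨p, hp, .inl (by rw [hpm]; exact hlarge.trans_eq (by ring)),
      fun b₁ b₂ t₁ t₂ h₁ h₂ => ?_⟩
    have hdec := runs_decompose e A B S p K hK hn (by omega) (by omega) h₁ h₂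
    rw [← hptail] at hdec
    have hbranch : Runs .branchLarge [r, fam e A, fam e B, enc e S, encodePoset e] _ _ :=
      .iteCons hlt (.app5 (.tail .arg0) .arg1 .arg2 .arg3 .arg4 hdec)
    exact (Ev.iteCons hcond (.app5 harg .arg0 .arg1 .arg2 .arg3 hbranch)).mono (by omega)
  · rw [decide_eq_false hlarge] at hlt
    have hbranch : ∀ v t, Runs .branchFrequent
        [num m, fam e (B.map (S \ ·)), fam e A, fam e B, enc e S, encodePoset e] v t →
        Runs .branchLarge [r, fam e A, fam e B, enc e S, encodePoset e] v _ := fun v t h =>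
      .iteNil hlt (.app6 hhead' (.app2 .arg2 .arg3 (runs_complement e B S))
        .arg1 .arg2 .arg3 .arg4 h)
    rcases stepOutcome_branchFrequent e A B S m K hK hn hAB hm
        ((by ring : m ^ 3 = m * (m * m)).trans_le (not_lt.1 hlarge)) with
      ⟨m, hm, hfA, hfB, hrun⟩ | ⟨p, hp, hgood, hrun⟩
    · refine .inl ⟨m, hm, hfA, hfB, ?_⟩
      exact (Ev.iteCons hcond (.app5 harg .arg0 .arg1 .arg2 .arg3 (hbranch _ _ hrun))).mono
        (by omega)
    · refine .inr ⟨p, hp, hgood, fun b₁ b₂ t₁ t₂ h₁ h₂ => ?_⟩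
      exact (Ev.iteCons hcond (.app5 harg .arg0 .arg1 .arg2 .arg3
        (hbranch _ _ (hrun b₁ b₂ t₁ t₂ h₁ h₂)))).mono (by omega)

/-- If one of the families is empty, then the test is decided without recursion. -/
theorem runs_testDuality_of_eq_nil {A B : List (Finset P)} (hAB : A = [] ∨ B = [])
    {S : Finset P} (hB : ∀ X ∈ B, X ⊆ S) (K : ℕ) (hK : 1000 ≤ K) (hn : n ≤ K)
    (hlen : A.length + B.length ≤ K) :
    Runs .testDuality (testArgs e A B S) (ofBool (decide (DualIn S A B))) (K ^ 13) := by
  have b1 : (A.length + 1) * (160 * n + 80) ≤ (K + 1) * (160 * K + 80) := by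
    gcongr
    omega
  have b2 : (B.length + 1) * (160 * n + 80) ≤ (K + 1) * (160 * K + 80) := by
    gcongr
    omega
  have b3 : (K + 1) * (160 * K + 80) + 100 * K + 200 ≤ K ^ 13 := by
    calc _ ≤ K ^ 3 := by
          obtain ⟨j, rfl⟩ := Nat.exists_eq_add_of_le hK
          ring_nf
          omega
      _ ≤ K ^ 13 := Nat.pow_le_pow_right (by omega) (by omega)
  cases A with
  | nil =>
    have h : DualIn S [] B ↔ S ∈ B := by
      rw [dualIn_nil_left]
      refine ⟨fun ⟨b, hb, hSb⟩ => ?_, fun h => ⟨S, h, le_rfl⟩⟩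
      rwa [(hB b hb).antisymm hSb] at hb
    rw [decide_eq_decide.2 h]
    have hcond : Ev (ofList (testArgs e [] B S)) (Expr.and (arg 0) (arg 1)) .nil 4 :=
      .iteNil .arg0 .nil
    have heasy : Runs .easyTest [fam e [], fam e B, enc e S] (ofBool (decide (S ∈ B))) _ :=
      .iteNil .arg0 (.app2 .arg2 .arg1 (runs_mem_fam e S B))
    exact (Ev.iteNil hcond (.app3 .arg0 .arg1 .arg2 heasy)).mono (by omega)
  | cons a A =>
    obtain rfl := hAB.resolve_left (by simp)
    rw [decide_eq_decide.2 dualIn_nil_right]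
    have hcond : Ev (ofList (testArgs e (a :: A) [] S)) (Expr.and (arg 0) (arg 1)) .nil 6 :=
      .iteCons .arg0 .arg1
    have hmem := runs_mem_fam e (S \ S) (a :: A)
    rw [Finset.sdiff_self] at hmem
    have heasy : Runs .easyTest [fam e (a :: A), fam e [], enc e S]
        (ofBool (decide (∅ ∈ a :: A))) _ :=
      .iteCons .arg0 (.app2 (.app2 .arg2 .arg2 (runs_diff_enc e S S)) .arg0
        (by rw [Finset.sdiff_self]; exact hmem))
    exact (Ev.iteNil hcond (.app3 .arg0 .arg1 .arg2 heasy)).mono (by omega)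

end Step

/-! ### The recursion -/

section Recursion

/-- The exponent in the bound on the number of recursive calls, for a subposet with `s` elements and
families with the product `v` of their cardinalities.  The reciprocal of `E` is a lower bound for
the frequency of pivots that are chosen for their frequency.  The logarithm is that of `v + 1`, as
one of the families may become empty. -/
noncomputable def depth (E : ℝ) (s v : ℕ) : ℝ :=
  1 + 3 * (s : ℝ) ^ (2 / 3 : ℝ) + 2 * E * Real.log (v + 1)

theorem depth_mono {E : ℝ} (hE : 0 ≤ E) {s s' v v' : ℕ} (hs : s ≤ s') (hv : v ≤ v') :
    depth E s v ≤ depth E s' v' := by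
  unfold depth
  gcongr

theorem one_le_depth {E : ℝ} (hE : 0 ≤ E) (s v : ℕ) : 1 ≤ depth E s v := by
  have h1 : 0 ≤ Real.log ((v : ℝ) + 1) := Real.log_nonneg (by linarith [v.cast_nonneg (α := ℝ)])
  have h2 : 0 ≤ (s : ℝ) ^ (2 / 3 : ℝ) := by positivity
  unfold depth
  nlinarith [mul_nonneg hE h1]

theorem rpow_two_thirds_sub_le {s a : ℝ} (hs : 0 < s) (has : a ≤ s)
    (ha : s ≤ (2 * a) ^ 3) (ha0 : 0 ≤ a) :
    (s - a) ^ (2 / 3 : ℝ) ≤ s ^ (2 / 3 : ℝ) - 1 / 3 := by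
  have h1 : (1 + -(a / s)) ^ (2 / 3 : ℝ) ≤ 1 + 2 / 3 * -(a / s) :=
    rpow_one_add_le_one_add_mul_self (by
      have := (div_le_one hs).2 has
      linarith) (by norm_num) (by norm_num)
  have h2 : s - a = s * (1 + -(a / s)) := by field_simp; ring
  have h3 : s ^ (1 / 3 : ℝ) ≤ 2 * a := by
    calc s ^ (1 / 3 : ℝ) ≤ ((2 * a) ^ 3) ^ (1 / 3 : ℝ) := by gcongr
      _ = 2 * a := by
        rw [one_div]
        exact Real.pow_rpow_inv_natCast (by positivity) three_ne_zero
  have h4 : s ^ (2 / 3 : ℝ) * (a / s) * s ^ (1 / 3 : ℝ) = a := by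
    rw [mul_right_comm, ← Real.rpow_add hs]
    norm_num
    field_simp
  have h5 : 1 / 2 ≤ s ^ (2 / 3 : ℝ) * (a / s) := by
    have hpos : 0 < s ^ (1 / 3 : ℝ) := by positivity
    by_contra hcon
    nlinarith [mul_lt_mul_of_pos_right (not_le.1 hcon) hpos]
  rw [h2, Real.mul_rpow hs.le (by
    have := (div_le_one hs).2 has
    linarith)]
  nlinarith [mul_le_mul_of_nonneg_left h1 (by positivity : 0 ≤ s ^ (2 / 3 : ℝ))]

/-- The first summand of `depth` drops when `a` elements are removed. -/
theorem depth_le_of_large {E : ℝ} (hE : 0 ≤ E) {s a v v' : ℕ} (hs : 0 < s) (has : a ≤ s)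
    (ha : s ≤ (2 * a) ^ 3) (hv : v' ≤ v) : depth E (s - a) v' ≤ depth E s v - 1 := by
  refine (depth_mono hE le_rfl hv).trans ?_
  have := rpow_two_thirds_sub_le (s := s) (a := a) (by exact_mod_cast hs) (by exact_mod_cast has)
    (by exact_mod_cast ha) (by positivity)
  rw [← Nat.cast_sub has] at this
  unfold depth
  linarith

/-- The second summand of `depth` drops when the product of the cardinalities is multiplied by
`1 - 1 / E`. -/
theorem depth_le_of_frequent {E : ℝ} (hE : 0 < E) {s s' v v' : ℕ} (hs : s' ≤ s) (hv : 1 ≤ v)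
    (hv' : E * v' ≤ E * v - v) : depth E s' v' ≤ depth E s v - 1 := by
  refine (depth_mono hE.le hs le_rfl).trans ?_
  have hv1 : (1 : ℝ) ≤ v := by exact_mod_cast hv
  have hv0 : (0 : ℝ) ≤ v' := v'.cast_nonneg
  have h1 : ((v' : ℝ) + 1) / (v + 1) ≤ 1 - 1 / (2 * E) := by
    rw [div_le_iff₀ (by linarith)]
    have h : (1 - 1 / (2 * E)) * ((v : ℝ) + 1) = (2 * E * (v + 1) - (v + 1)) / (2 * E) := by
      field_simp
    rw [h, le_div_iff₀ (by positivity)]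
    nlinarith
  have h2 := Real.log_le_sub_one_of_pos (x := ((v' : ℝ) + 1) / (v + 1)) (by positivity)
  rw [Real.log_div (by positivity) (by positivity)] at h2
  have h3 : Real.log (v' + 1) ≤ Real.log (v + 1) - 1 / (2 * E) := by linarith
  have h4 : 2 * E * Real.log (v' + 1) ≤ 2 * E * (Real.log (v + 1) - 1 / (2 * E)) := by gcongr
  have h5 : 2 * E * (Real.log (v + 1) - 1 / (2 * E)) = 2 * E * Real.log (v + 1) - 1 := by
    field_simp
  unfold depth
  linarith

/-- The bound for the number of calls, where `k` is the `depth`. -/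
noncomputable def calls (s : ℕ) (k : ℝ) : ℝ := 2 * ((s : ℝ) + 1) ^ k - 1

/-- The bound follows from `s ^ k + (s + 1) ^ (k - 1) ≤ (s + 1) ^ k`. -/
theorem calls_recursion {s s₁ s₂ : ℕ} {k k₁ k₂ : ℝ} (h₁ : s₁ < s) (h₂ : s₂ < s) (hk : 1 ≤ k)
    (hk₁ : k₁ ≤ k - 1) (hk₂ : k₂ ≤ k) : 1 + calls s₁ k₁ + calls s₂ k₂ ≤ calls s k := by
  have h₁' : (s₁ : ℝ) + 1 ≤ s + 1 := by
    have : (s₁ : ℝ) < s := by exact_mod_cast h₁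
    linarith
  have h₂' : (s₂ : ℝ) + 1 ≤ s := by exact_mod_cast h₂
  have hs : (0 : ℝ) < s := by exact_mod_cast (Nat.zero_le _).trans_lt h₁
  have b1 : ((s₁ : ℝ) + 1) ^ k₁ ≤ ((s : ℝ) + 1) ^ (k - 1) :=
    (Real.rpow_le_rpow_of_exponent_le (by linarith [s₁.cast_nonneg (α := ℝ)]) hk₁).trans
      (Real.rpow_le_rpow (by positivity) h₁' (by linarith))
  have b2 : ((s₂ : ℝ) + 1) ^ k₂ ≤ s * ((s : ℝ) + 1) ^ (k - 1) := by
    calc ((s₂ : ℝ) + 1) ^ k₂ ≤ ((s₂ : ℝ) + 1) ^ k :=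
          Real.rpow_le_rpow_of_exponent_le (by linarith [s₂.cast_nonneg (α := ℝ)]) hk₂
      _ ≤ (s : ℝ) ^ k := Real.rpow_le_rpow (by positivity) h₂' (by linarith)
      _ = s * (s : ℝ) ^ (k - 1) := by
          rw [← Real.rpow_one_add' hs.le (by linarith)]
          congr 1
          ring
      _ ≤ s * ((s : ℝ) + 1) ^ (k - 1) := by
          gcongr
          linarith
  have b3 : ((s : ℝ) + 1) ^ k = (s + 1) * ((s : ℝ) + 1) ^ (k - 1) := by
    rw [← Real.rpow_one_add' (by positivity) (by linarith)]
    congr 1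
    ring
  unfold calls
  rw [b3]
  linarith

theorem one_le_calls (s : ℕ) {k : ℝ} (hk : 0 ≤ k) : 1 ≤ calls s k := by
  have := Real.one_le_rpow (x := (s : ℝ) + 1) (by linarith [s.cast_nonneg (α := ℝ)]) hk
  unfold calls
  linarith

open scoped Classical

variable {P : Type*}

/-- A frequent element has a frequency of at least `1 / (D * log_{4/3} N₀)`. -/
theorem length_le_of_not_infrequent {C : List (Finset P)} {k N N₀ : ℕ} {q : P}
    (h : ¬ Infrequent C k N q) {D : ℝ} (hD : (k : ℝ) ≤ D) (hN : 1 ≤ N) (hN₀ : N ≤ N₀) :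
    (C.length : ℝ) ≤ D * Real.logb (4 / 3) N₀ * (having C q).length := by
  rw [Infrequent, not_lt] at h
  have hNpos : (0 : ℝ) < N := by exact_mod_cast hN
  have h' : (4 : ℝ) ^ C.length ≤ (N : ℝ) ^ (k * (having C q).length) * 3 ^ C.length := by
    exact_mod_cast h
  have h1 := Real.log_le_log (by positivity) h'
  rw [Real.log_mul (by positivity) (by positivity), Real.log_pow, Real.log_pow, Real.log_pow] at h1
  push_cast at h1
  have h2 : Real.log (4 / 3) = Real.log 4 - Real.log 3 :=
    Real.log_div (by norm_num) (by norm_num)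
  have hpos : 0 < Real.log (4 / 3) := Real.log_pos (by norm_num)
  have h3 : Real.log N ≤ Real.log N₀ := Real.log_le_log hNpos (by exact_mod_cast hN₀)
  have h4 : 0 ≤ Real.log N := Real.log_natCast_nonneg N
  have h5 : (k : ℝ) * (having C q).length * Real.log N ≤
      D * (having C q).length * Real.log N₀ := by
    have : (0 : ℝ) ≤ D := k.cast_nonneg.trans hD
    gcongr
  rw [Real.logb, mul_div_assoc', div_mul_eq_mul_div, le_div_iff₀ hpos, h2]
  linarith

theorem length_having_add_length_having_complement {S : Finset P} (B : List (Finset P)) {p : P}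
    (hp : p ∈ S) : (having B p).length + (having (B.map (S \ ·)) p).length = B.length := by
  induction B with
  | nil => rfl
  | cons X B ih =>
    rw [having, having] at *
    by_cases h : p ∈ X <;> simp [h, hp] <;> omega

variable [PartialOrder P] {n : ℕ} (e : Fin n ≃ P)

/-- For a good pivot, `depth` drops by one in one of the branches. -/
theorem depth_le_of_goodPivot {A B : List (Finset P)} (hA' : A ≠ []) (hB' : B ≠ [])
    {S : Finset P} {p : P} (hp : p ∈ S) (hgood : GoodPivot A B S p) {s₀ N₀ : ℕ}
    (hs₀ : S.card ≤ s₀) (hN₀ : A.length + B.length ≤ N₀) {E : ℝ}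
    (hE : E = (s₀ : ℝ) ^ (2 / 3 : ℝ) * Real.logb (4 / 3) N₀) (hE0 : 0 ≤ E) :
    depth E (S \ below S p).card
        ((removeAll A (below S p)).length * (removeAll (having B p) (below S p)).length) ≤
      depth E S.card (A.length * B.length) - 1 ∨
    depth E (S \ above S p).card ((lacking A p).length * (removeAll B (above S p)).length) ≤
      depth E S.card (A.length * B.length) - 1 := by
  have hApos : 0 < A.length := List.length_pos_iff.2 hA'
  have hBpos : 0 < B.length := List.length_pos_iff.2 hB'
  have hSpos : 0 < S.card := Finset.card_pos.2 ⟨p, hp⟩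
  have hv₁ : (removeAll A (below S p)).length * (removeAll (having B p) (below S p)).length ≤
      A.length * (having B p).length :=
    Nat.mul_le_mul (length_removeAll_le _ _) (length_removeAll_le _ _)
  have hv₁' : A.length * (having B p).length ≤ A.length * B.length :=
    Nat.mul_le_mul_left _ (length_having_le _ _)
  have hv₂ : (lacking A p).length * (removeAll B (above S p)).length ≤
      (lacking A p).length * B.length := Nat.mul_le_mul_left _ (length_removeAll_le _ _)
  have hv₂' : (lacking A p).length * B.length ≤ A.length * B.length :=
    Nat.mul_le_mul_right _ (length_lacking_le _ _)
  have hbelow : below S p ⊆ S := Finset.filter_subset _ _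
  have habove : above S p ⊆ S := Finset.filter_subset _ _
  rcases hgood with hlarge | ⟨m, hm3, hmax, q, hq, hfreq⟩
  · rw [Finset.card_sdiff_of_subset hbelow, Finset.card_sdiff_of_subset habove]
    rw [nbhdCard] at hlarge
    rcases le_total (above S p).card (below S p).card with h | h
    · exact .inl (depth_le_of_large hE0 hSpos (Finset.card_le_card hbelow)
        (hlarge.le.trans (Nat.pow_le_pow_left (by omega) 3)) (hv₁.trans hv₁'))
    · exact .inr (depth_le_of_large hE0 hSpos (Finset.card_le_card habove)
        (hlarge.le.trans (Nat.pow_le_pow_left (by omega) 3)) (hv₂.trans hv₂'))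
  · set C := B.map (S \ ·) with hC
    have hCB : C.length = B.length := by rw [hC, List.length_map]
    have hmm : ((m * m : ℕ) : ℝ) ≤ (s₀ : ℝ) ^ (2 / 3 : ℝ) := by
      have h1 : (m : ℝ) ^ 3 ≤ s₀ := by exact_mod_cast hm3.trans hs₀
      calc ((m * m : ℕ) : ℝ) = ((m : ℝ) ^ 3) ^ (2 / 3 : ℝ) := by
            rw [← Real.rpow_natCast_mul (by positivity)]
            norm_num
            ring
        _ ≤ (s₀ : ℝ) ^ (2 / 3 : ℝ) := by gcongr
    have hm : (m : ℝ) ≤ (s₀ : ℝ) ^ (2 / 3 : ℝ) :=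
      le_trans (by exact_mod_cast Nat.le_mul_self m) hmm
    -- Some element has a large score, so the pivot has a large score.
    have hscore : ((A.length * B.length : ℕ) : ℝ) ≤ E * score A C q := by
      have hmaxcast : ((score A C q : ℕ) : ℝ) =
          max ((having A q).length * C.length : ℝ) ((having C q).length * A.length) := by
        rw [score]
        push_cast
        rfl
      rw [hmaxcast, hE]
      rw [hE] at hE0
      push_cast
      rcases hfreq with h | h
      · have h1 := length_le_of_not_infrequent h hm (by omega) hN₀
        calc (A.length : ℝ) * B.length ≤
              (s₀ : ℝ) ^ (2 / 3 : ℝ) * Real.logb (4 / 3) N₀ * (having A q).length * B.length := by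
              gcongr
          _ = (s₀ : ℝ) ^ (2 / 3 : ℝ) * Real.logb (4 / 3) N₀ * ((having A q).length * C.length) := by
              rw [hCB]; ring
          _ ≤ _ := mul_le_mul_of_nonneg_left (le_max_left _ _) hE0
      · have h1 := length_le_of_not_infrequent h hmm (by omega) hN₀
        rw [hCB] at h1
        calc (A.length : ℝ) * B.length ≤ A.length *
              ((s₀ : ℝ) ^ (2 / 3 : ℝ) * Real.logb (4 / 3) N₀ * (having C q).length) := by
              gcongr
          _ = (s₀ : ℝ) ^ (2 / 3 : ℝ) * Real.logb (4 / 3) N₀ *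
              ((having C q).length * A.length) := by ring
          _ ≤ _ := mul_le_mul_of_nonneg_left (le_max_right _ _) hE0
    have hscore' : ((A.length * B.length : ℕ) : ℝ) ≤ E * score A C p :=
      hscore.trans (mul_le_mul_of_nonneg_left (by exact_mod_cast hmax q hq) hE0)
    have hvpos : 1 ≤ A.length * B.length := Nat.mul_pos hApos hBpos
    have hEpos : 0 < E := by
      rcases hE0.lt_or_eq with h | h
      · exact h
      · rw [← h, zero_mul] at hscore
        have : (1 : ℝ) ≤ ((A.length * B.length : ℕ) : ℝ) := by exact_mod_cast hvpos
        linarith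
    rcases max_choice ((having A p).length * C.length) ((having C p).length * A.length) with h | h
    · rw [score, h, hCB] at hscore'
      refine .inr (depth_le_of_frequent hEpos (Finset.card_le_card Finset.sdiff_subset) hvpos ?_)
      have h1 : ((having A p).length : ℝ) + (lacking A p).length = A.length := by
        exact_mod_cast length_having_add_length_lacking A p
      have h2 : (((lacking A p).length * (removeAll B (above S p)).length : ℕ) : ℝ) ≤
          (lacking A p).length * B.length := by exact_mod_cast hv₂
      have h3 := mul_le_mul_of_nonneg_left h2 hE0
      push_cast at hscore' h3 ⊢
      have h4 : E * ((A.length : ℝ) * B.length) = E * ((having A p).length * B.length) +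
          E * ((lacking A p).length * B.length) := by rw [← h1]; ring
      linarith
    · rw [score, h] at hscore'
      refine .inl (depth_le_of_frequent hEpos (Finset.card_le_card Finset.sdiff_subset) hvpos ?_)
      have h1 : ((having B p).length : ℝ) + (having C p).length = B.length := by
        exact_mod_cast length_having_add_length_having_complement B hp
      have h2 : (((removeAll A (below S p)).length *
          (removeAll (having B p) (below S p)).length : ℕ) : ℝ) ≤
          A.length * (having B p).length := by exact_mod_cast hv₁
      have h3 := mul_le_mul_of_nonneg_left h2 hE0
      push_cast at hscore' h3 ⊢
      have h4 : E * ((A.length : ℝ) * B.length) = E * ((having C p).length * A.length) +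
          E * (A.length * (having B p).length) := by rw [← h1]; ring
      linarith

/-- Correctness and running time of the recursive duality test.  Here `K ^ 13` bounds the work of a
single call. -/
theorem runs_testDuality (N₀ K : ℕ) (hK : 1000 ≤ K) (hn : n ≤ K) (hN₀K : N₀ ≤ K) {E : ℝ}
    (hE : E = (n : ℝ) ^ (2 / 3 : ℝ) * Real.logb (4 / 3) N₀) (S : Finset P)
    (A B : List (Finset P)) (hA : ∀ X ∈ A, IsDownset S X) (hB : ∀ X ∈ B, IsDownset S X)
    (hN₀ : A.length + B.length ≤ N₀) :
    ∃ b t, Runs .testDuality (testArgs e A B S) (ofBool b) t ∧ (b = true ↔ DualIn S A B) ∧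
      (t : ℝ) ≤ K ^ 13 * calls S.card (depth E S.card (A.length * B.length)) := by
  have hE0 : 0 ≤ E := by
    rw [hE, Real.logb]
    have := Real.log_natCast_nonneg N₀
    have := Real.log_pos (x := 4 / 3) (by norm_num)
    positivity
  have hK0 : (0 : ℝ) ≤ (K : ℝ) ^ 13 := by positivity
  induction S using Finset.strongInduction generalizing A B with
  | H S ih =>
    have hd := one_le_depth hE0 S.card (A.length * B.length)
    have hc : (K : ℝ) ^ 13 ≤ K ^ 13 * calls S.card (depth E S.card (A.length * B.length)) :=
      le_mul_of_one_le_right hK0 (one_le_calls _ (zero_le_one.trans hd))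
    by_cases hnil : A = [] ∨ B = []
    · exact ⟨_, _, runs_testDuality_of_eq_nil e hnil (fun X hX => (hB X hX).1) K hK hn
        (hN₀.trans hN₀K), decide_eq_true_iff, by exact_mod_cast hc⟩
    · push Not at hnil
      rcases stepOutcome_testDuality e hnil.1 hnil.2 S K hK hn (hN₀.trans hN₀K) with
        ⟨m, hm, hfA, hfB, hrun⟩ | ⟨p, hp, hgood, hrun⟩
      · have hnot := not_dualIn_of_infrequent hA hnil.1 hnil.2 hm hfA hfB
        exact ⟨_, _, hrun, by simpa using hnot, by exact_mod_cast hc⟩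
      · have hs₁ : S \ below S p ⊂ S := Finset.sdiff_ssubset (Finset.filter_subset _ _)
          ⟨p, mem_below.2 ⟨hp, le_rfl⟩⟩
        have hs₂ : S \ above S p ⊂ S := Finset.sdiff_ssubset (Finset.filter_subset _ _)
          ⟨p, mem_above.2 ⟨hp, le_rfl⟩⟩
        have hlA := length_removeAll_le A (below S p)
        have hlB := length_removeAll_le B (above S p)
        have hlB' := (length_removeAll_le (having B p) (below S p)).trans (length_having_le B p)
        have hlA' := length_lacking_le A p
        obtain ⟨b₁, t₁, hrun₁, hb₁, ht₁⟩ := ih _ hs₁ (removeAll A (below S p))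
          (removeAll (having B p) (below S p))
          (fun X hX => by
            obtain ⟨Z, hZ, rfl⟩ := mem_removeAll.1 hX
            exact (hA Z hZ).sdiff_below)
          (fun X hX => by
            obtain ⟨Z, hZ, rfl⟩ := mem_removeAll.1 hX
            exact (hB Z (mem_having.1 hZ).1).sdiff_below) (by omega)
        obtain ⟨b₂, t₂, hrun₂, hb₂, ht₂⟩ := ih _ hs₂ (lacking A p) (removeAll B (above S p))
          (fun X hX => (hA X (mem_lacking.1 hX).1).of_lacking hp (mem_lacking.1 hX).2)
          (fun X hX => by
            obtain ⟨Z, hZ, rfl⟩ := mem_removeAll.1 hX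
            exact (hB Z hZ).sdiff_above) (by omega)
        refine ⟨_, _, hrun b₁ b₂ t₁ t₂ hrun₁ hrun₂, ?_, ?_⟩
        · rw [Bool.and_eq_true, hb₁, hb₂, dualIn_iff_decompose hB hp]
        · have hm₁ : depth E (S \ below S p).card ((removeAll A (below S p)).length *
              (removeAll (having B p) (below S p)).length) ≤
              depth E S.card (A.length * B.length) :=
            depth_mono hE0 (Finset.card_le_card hs₁.subset) (Nat.mul_le_mul hlA hlB')
          have hm₂ : depth E (S \ above S p).card ((lacking A p).length *
              (removeAll B (above S p)).length) ≤ depth E S.card (A.length * B.length) :=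
            depth_mono hE0 (Finset.card_le_card hs₂.subset) (Nat.mul_le_mul hlA' hlB)
          have hrec := (depth_le_of_goodPivot hnil.1 hnil.2 hp hgood
            (card_le_of_equiv e S) hN₀ hE hE0).elim
            (fun h => calls_recursion (Finset.card_lt_card hs₁) (Finset.card_lt_card hs₂) hd h hm₂)
            (fun h => by
              linarith [calls_recursion (Finset.card_lt_card hs₂) (Finset.card_lt_card hs₁)
                hd h hm₁])
          have := mul_le_mul_of_nonneg_left hrec hK0
          push_cast
          linarith

end Recursion

/-! ### The bound on the running time -/

/-- The exponent `2 / 3` becomes `0.67 = 2 / 3 + 1 / 300`, because the logarithm of `n` is bounded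
by a multiple of `n ^ (1 / 300)`. -/
theorem time_bound {n a b : ℕ} (hn : 1 ≤ n) (hab : 2 ≤ a + b) {E t : ℝ}
    (hE : E = (n : ℝ) ^ (2 / 3 : ℝ) * Real.logb (4 / 3) (a + b : ℕ))
    (ht : t ≤ 2 * ((n + (a + b) + 1000 : ℕ) : ℝ) ^ 13 * ((n : ℝ) + 1) ^ depth E n (a * b)) :
    t ≤ 2 ^ (20000 * (n : ℝ) ^ (0.67 : ℝ) * Real.logb 2 ((a : ℝ) + (b : ℝ)) ^ 3) := by
  set N : ℝ := (a : ℝ) + b with hN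
  have hNcast : ((a + b : ℕ) : ℝ) = N := by push_cast; rfl
  have hN2 : 2 ≤ N := by rw [← hNcast]; exact_mod_cast hab
  have hn1 : (1 : ℝ) ≤ n := by exact_mod_cast hn
  set L := Real.logb 2 N with hL
  have hlog2 : 0 < Real.log 2 := Real.log_pos (by norm_num)
  have hlog2' : Real.log 2 ≤ 1 := by linarith [Real.log_two_lt_d9]
  have hlog2'' : 1 / 2 ≤ Real.log 2 := by linarith [Real.log_two_gt_d9]
  have hlogN : Real.log N = L * Real.log 2 := by
    rw [hL, Real.logb]
    field_simp
  have hL1 : 1 ≤ L := by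
    rw [hL, Real.le_logb_iff_rpow_le (by norm_num) (by linarith), Real.rpow_one]
    exact hN2
  have hlogNL : Real.log N ≤ L := by rw [hlogN]; nlinarith
  have hlogN0 : 0 ≤ Real.log N := Real.log_nonneg (by linarith)
  set y := (n : ℝ) ^ (1 / 300 : ℝ) with hy
  set z := (n : ℝ) ^ (2 / 3 : ℝ) with hz
  set x := (n : ℝ) ^ (0.67 : ℝ) with hx
  have hy1 : 1 ≤ y := Real.one_le_rpow hn1 (by norm_num)
  have hz1 : 1 ≤ z := Real.one_le_rpow hn1 (by norm_num)
  have hx1 : 1 ≤ x := Real.one_le_rpow hn1 (by norm_num)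
  have hzy : z * y = x := by
    rw [hz, hy, hx, ← Real.rpow_add (by linarith)]
    norm_num
  have hyx : y ≤ x := by nlinarith
  have hlogn : Real.log n ≤ 300 * y := by
    have := Real.log_le_rpow_div (x := n) (ε := 1 / 300) (by linarith) (by norm_num)
    rw [← hy] at this
    linarith
  have hlogn1 : Real.log (n + 1) ≤ 301 * y := by
    have h1 : Real.log ((n : ℝ) + 1) ≤ Real.log (2 * n) :=
      Real.log_le_log (by linarith) (by linarith)
    rw [Real.log_mul (by norm_num) (by linarith)] at h1
    linarith
  have hlogn0 : 0 ≤ Real.log ((n : ℝ) + 1) := Real.log_nonneg (by linarith)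
  have hlogK : Real.log (n + N + 1000) ≤ 311 * (x * L) := by
    have h1 : (n : ℝ) + N + 1000 ≤ 2 ^ 10 * (n * N) := by nlinarith
    have h2 := Real.log_le_log (by linarith) h1
    rw [Real.log_mul (by norm_num) (by nlinarith), Real.log_mul (by linarith) (by linarith),
      Real.log_pow] at h2
    push_cast at h2
    have h3 : 1 ≤ x * L := one_le_mul_of_one_le_of_one_le hx1 hL1
    have h4 : x ≤ x * L := le_mul_of_one_le_right (by linarith) hL1
    have h5 : L ≤ x * L := le_mul_of_one_le_left (by linarith) hx1
    linarith
  have hlogb : Real.logb (4 / 3) N ≤ 3 * L := by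
    have hpos : 0 < Real.log (4 / 3) := Real.log_pos (by norm_num)
    have h1 : Real.log 2 ≤ 3 * Real.log (4 / 3) := by
      have : Real.log 2 ≤ Real.log ((4 / 3) ^ 3) := Real.log_le_log (by norm_num) (by norm_num)
      rw [Real.log_pow] at this
      exact_mod_cast this
    rw [Real.logb, div_le_iff₀ hpos, hlogN]
    nlinarith
  have hlogb0 : 0 ≤ Real.logb (4 / 3) N := Real.logb_nonneg (by norm_num) (by linarith)
  have hEz : E ≤ z * (3 * L) := by
    rw [hE, hNcast]
    gcongr
  have hE0 : 0 ≤ E := by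
    rw [hE, hNcast]
    positivity
  have hlogv : Real.log (((a * b : ℕ) : ℝ) + 1) ≤ 2 * L := by
    have h1 : ((a * b : ℕ) : ℝ) + 1 ≤ N ^ 2 := by
      rw [← hNcast]
      have : a * b + 1 ≤ (a + b) ^ 2 := by nlinarith [sq_nonneg a, sq_nonneg b]
      exact_mod_cast this
    have h2 := Real.log_le_log (by positivity) h1
    rw [Real.log_pow] at h2
    push_cast at h2 ⊢
    linarith
  have hdepth : depth E n (a * b) ≤ 16 * (z * L ^ 2) := by
    have h1 : E * Real.log (((a * b : ℕ) : ℝ) + 1) ≤ z * (3 * L) * (2 * L) := by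
      have : 0 ≤ Real.log (((a * b : ℕ) : ℝ) + 1) := Real.log_nonneg (by
        linarith [(a * b).cast_nonneg (α := ℝ)])
      gcongr
    have h2 : 1 ≤ L ^ 2 := one_le_pow₀ hL1
    have h3 : z ≤ z * L ^ 2 := le_mul_of_one_le_right (by linarith) h2
    have h4 : z * (3 * L) * (2 * L) = 6 * (z * L ^ 2) := by ring
    unfold depth
    rw [← hz]
    linarith
  have hdl : depth E n (a * b) * Real.log (n + 1) ≤ 4816 * (x * L ^ 2) := by
    calc depth E n (a * b) * Real.log (n + 1) ≤ 16 * (z * L ^ 2) * (301 * y) := by gcongr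
      _ = 4816 * (x * L ^ 2) := by rw [← hzy]; ring
  have hKcast : ((n + (a + b) + 1000 : ℕ) : ℝ) = n + N + 1000 := by push_cast; rfl
  rw [hKcast] at ht
  have hKpos : 0 < (n : ℝ) + N + 1000 := by linarith
  refine ht.trans ?_
  rw [← Real.log_le_log_iff (by positivity) (by positivity), Real.log_mul (by positivity)
    (by positivity), Real.log_mul (by norm_num) (by positivity), Real.log_pow,
    Real.log_rpow (by linarith), Real.log_rpow (by norm_num)]
  push_cast
  have h3 : 1 ≤ x * L ^ 3 := one_le_mul_of_one_le_of_one_le hx1 (one_le_pow₀ hL1)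
  have h4 : x * L ≤ x * L ^ 3 :=
    mul_le_mul_of_nonneg_left (le_self_pow₀ hL1 (by norm_num)) (by linarith)
  have h5 : x * L ^ 2 ≤ x * L ^ 3 :=
    mul_le_mul_of_nonneg_left (pow_le_pow_right₀ hL1 (by norm_num)) (by linarith)
  have h6 : x * L ^ 3 * (1 / 2) ≤ x * L ^ 3 * Real.log 2 :=
    mul_le_mul_of_nonneg_left hlog2'' (by linarith)
  linarith

/-! ### The whole algorithm -/

section Main

open scoped Classical

variable {P : Type*} [PartialOrder P] [Fintype P] {n : ℕ} (e : Fin n ≃ P)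

/-- The elements of a downset. -/
noncomputable def lowerFinset (X : LowerSet P) : Finset P := Finset.univ.filter (· ∈ X)

theorem mem_lowerFinset {X : LowerSet P} {p : P} : p ∈ lowerFinset X ↔ p ∈ X := by
  simp [lowerFinset]

theorem lowerFinset_subset {X Y : LowerSet P} : lowerFinset X ⊆ lowerFinset Y ↔ X ≤ Y := by
  simp only [Finset.subset_iff, mem_lowerFinset]
  rfl

theorem isDownset_univ_iff {X : Finset P} :
    IsDownset Finset.univ X ↔ ∃ Y : LowerSet P, lowerFinset Y = X := by
  constructor
  · rintro ⟨-, h⟩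
    refine ⟨⟨X, fun x y hyx hx => h x hx y (Finset.mem_univ _) hyx⟩, ?_⟩
    ext p
    rw [mem_lowerFinset]
    rfl
  · rintro ⟨Y, rfl⟩
    refine ⟨Finset.subset_univ _, fun x hx y _ hyx => ?_⟩
    rw [mem_lowerFinset] at *
    exact Y.lower hyx hx

theorem dualIn_univ_iff (A B : List (LowerSet P)) :
    DualIn Finset.univ (A.map lowerFinset) (B.map lowerFinset) ↔
      AreDual {X | X ∈ A} {X | X ∈ B} := by
  simp only [DualIn, AreDual, lowerFinset_subset, isDownset_univ_iff, Set.mem_ofPred_eq,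
    forall_exists_index, and_imp, forall_apply_eq_imp_iff, forall_apply_eq_imp_iff₂, List.mem_map,
    exists_exists_and_eq_and]

theorem encodeDownsets_eq (A : List (LowerSet P)) :
    encodeDownsets e A = fam e (A.map lowerFinset) := by
  rw [encodeDownsets, fam, List.map_map]
  congr 1
  refine List.map_congr_left fun X _ => ?_
  simp only [Function.comp_apply, enc, mem_lowerFinset]

theorem runs_main (A B : List (LowerSet P)) {v : Tree} {t : ℕ}
    (h : Runs .testDuality
      (testArgs e (A.map lowerFinset) (B.map lowerFinset) Finset.univ) v t) :
    Runs .main [encodeDownsets e A, encodeDownsets e B, encodePoset e] v (t + 20 * n + 60) := by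
  have hfull : Runs .full [encodePoset e] (enc e Finset.univ) (20 * (n + 1)) := by
    have h : enc e Finset.univ = encodePred fun _ : Fin n => True := by simp [enc]
    rw [h]
    exact runs_full _
  rw [encodeDownsets_eq, encodeDownsets_eq]
  exact (Ev.app4 .arg0 .arg1 (.app1 .arg2 hfull) .arg2 h).mono (by omega)

end Main

end TreeLang

theorem mainTheorem3 :
    ∃ C : ℝ, ∀ (n : ℕ) (P : Type*) [PartialOrder P] (e : Fin n ≃ P)
      (A B : List (LowerSet P)),
      A.Nodup → B.Nodup →
      IsAntichain (· ≤ ·) {X | X ∈ A} → IsAntichain (· ≤ ·) {X | X ∈ B} →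
      ∃ (answer : Bool) (t : ℕ),
        TreeLang.HaltsWith TreeLang.code .main (TreeLang.encodeInput e A B)
          (TreeLang.Tree.ofBool answer) t ∧
        (answer = true ↔ AreDual {X | X ∈ A} {X | X ∈ B}) ∧
        (1 ≤ n → 2 ≤ A.length + B.length →
          (t : ℝ) ≤ 2 ^ (C * (n : ℝ) ^ (0.67 : ℝ) *
            Real.logb 2 ((A.length : ℝ) + (B.length : ℝ)) ^ 3)) := by
  refine ⟨20000, fun n P _ e A B _ _ _ _ => ?_⟩
  let _ : Fintype P := Fintype.ofEquiv _ e
  set N := A.length + B.length with hN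
  have hdown : ∀ l : List (LowerSet P), ∀ X ∈ l.map TreeLang.lowerFinset,
      TreeLang.IsDownset Finset.univ X := fun l X hX => by
    obtain ⟨Y, -, rfl⟩ := List.mem_map.1 hX
    exact TreeLang.isDownset_univ_iff.2 ⟨Y, rfl⟩
  obtain ⟨b, t, hrun, hb, ht⟩ := TreeLang.runs_testDuality e N (n + N + 1000) (by omega) (by omega)
    (by omega) rfl Finset.univ (A.map TreeLang.lowerFinset) (B.map TreeLang.lowerFinset)
    (hdown A) (hdown B) (by simp [hN])
  obtain ⟨t', ht', hmain⟩ := TreeLang.runs_main e A B hrun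
  refine ⟨b, t', hmain, hb.trans (TreeLang.dualIn_univ_iff A B), fun hn hAB => ?_⟩
  refine TreeLang.time_bound hn hAB rfl ?_
  have hcard : (Finset.univ : Finset P).card = n := by
    rw [Finset.card_univ, ← Fintype.card_congr e, Fintype.card_fin]
  rw [hcard, List.length_map, List.length_map, TreeLang.calls] at ht
  have ht'' : (t' : ℝ) ≤ t + (20 * n + 60) := by exact_mod_cast (by omega : t' ≤ t + (20 * n + 60))
  have hn0 : (0 : ℝ) ≤ n := n.cast_nonneg
  have hN0 : (0 : ℝ) ≤ N := N.cast_nonneg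
  have hK : (20 * n + 60 : ℝ) ≤ ((n + N + 1000 : ℕ) : ℝ) ^ 13 := by
    have h1 : (1 : ℝ) ≤ ((n + N + 1000 : ℕ) : ℝ) := by
      push_cast
      linarith
    have h2 : (20 * n + 60 : ℝ) ≤ ((n + N + 1000 : ℕ) : ℝ) ^ 2 := by
      push_cast
      nlinarith
    exact h2.trans (pow_le_pow_right₀ h1 (by norm_num))
  rw [← hN]
  linarith
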